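/- **Setting.** Consider the single-input single-output loop $e=r-y$, $q=K e$, $u=R q$, $y=G u$, where $K$, $G$ are linear time-invariant systems given by real state-space matrices $(A_K,B_K,C_K,D_K)$, $(A_G,B_G,C_G,D_G)$, and $R$ is a reset element $$\dot x=A_Rx+B_Rq,\quad u=C_Rx+D_Rq \text{ between resets},\qquad x(t^+)=A_\rho x(t)\text{ at a reset instant } t ,$$ resets taking place at zeros of $q$. Values of signals at a reset instant are the values just before the reset. The algebraic loop is well posed ($1+D_GD_RD_K\neq 0$), and the base-linear system (BLS, the loop without resets) is asymptotically stable. The reference is $r(t)=|R_I|\sin(\omega t+\angle R_I)$ with $\omega>0$, $R_I\in\mathbb C$; $j\omega$ is an eigenvalue of neither $A_K$ nor $A_G$. Put $$R_L=C_R(sI-A_R)^{-1}B_R+D_R,\quad R_L^X=(sI-A_R)^{-1}B_R,\quad R_\delta^X=(sI-A_R)^{-1}(A_\rho-I),\quad R_\delta=C_RR_\delta^X,$$ $$S_L=(1+GR_LK)^{-1},\qquad Q_\delta=KS_LGR_\delta,\qquad H=R_\delta^X-R_L^XKS_LGR_\delta,\qquad M=|K(j\omega)S_L(j\omega)R_I|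 .$$ Let $(A_Q,B_Q,C_Q,D_Q)$ and $(A_H,B_H,C_H,D_H)$ be real state-space realizations of $Q_\delta$ and $H$ with $A_Q$, $A_H$ asymptotically stable (all eigenvalues have negative real part). For $F\in\{Q,H\}$ write $$\Sigma_F=C_F\sum_{k\in\{2,4,6,\dots\}}\left(e^{A_Fk\pi/\omega}-e^{A_F(k-1)\pi/\omega}\right)B_F ,\qquad \sigma(x)=\frac{\Sigma_Q\,x}{M},\qquad \Phi(x)=\sin^{-1}\sigma(x).$$ **Assumptions.** Let $q_L$ be the signal $q$ in the $2\pi/\omega$-periodic response of the BLS to $r$. Suppose the reset loop has a $2\pi/\omega$-periodic response to $r$ with exactly two modelled resets per period, at the instants $t_\rho^\downarrow+p\pi/\omega$, $p\in\mathbb Z$, where $q=0$, and that $x(t+\pi/\omega)=-x(t)$ at these instants. The zero crossing at $t_\rho^\downarrow$ is descending: $\dot q(t_\rho^\downarrow)<0$ (derivative from the left, here and in (i)). Suppose further that at each reset instant $t$: (i) $\operatorname{sign}\dot q(t)=\operatorname{sign}\dot q_L(t)$; (ii) $\left|\sum_{p\ge1}C_Qe^{A_Qp\pi/\omega}B_Q\,x(t-p\pi/\omega)\right|<\sup_s|q_L(s)|$.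 Suppose finally that $\omega^2I+A_R^2$ is invertible. **Claim.** 1. $D_Q=0$ and $D_H=0$, and both series over $k$ converge. 2. The reset state $x=x(t_\rho^\downarrow)$ satisfies $$x=\Re\left\{R_L^X(j\omega)\,M\,e^{j(\pi/2-\Phi(x))}\right\}+\Sigma_H\,x. \qquad (*)$$ 3. Suppose the matrix in brackets below is invertible. Replace $\sin^{-1}$ and $\varphi\mapsto e^{j(\pi/2-\varphi)}$ in $(*)$ by their first-order Taylor polynomials at $0$ (small phase shift, $\Phi\ll\pi$). The resulting linearised equation has exactly one solution, namely $$\hat x=\left[I+(\omega^2I+A_R^2)^{-1}A_RB_R\,\Sigma_Q-\Sigma_H\right]^{-1}(\omega^2I+A_R^2)^{-1}\omega B_R\,M .$$ The reset state itself is given by this formula up to second order in the phase shift: for every component $i$, $$\left|x(t_\rho^\downarrow)_i-\hat x_i\right|\le\tfrac12\,\Phi\!\left(x(t_\rho^\downarrow)\right)^2\,|\hat x_i| .$$ -/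

import Mathlib

open Matrix Filter Topology

noncomputable section

namespace ResetControl

/-- A real matrix regarded as a complex one. -/
def toC {a b : ℕ} (M : Matrix (Fin a) (Fin b) ℝ) : Matrix (Fin a) (Fin b) ℂ :=
  M.map (fun x : ℝ => (x : ℂ))

/-- A real linear time-invariant system `v' = A v + B i`, `o = C v + D i` with `n` states,
`m` inputs and `p` outputs. -/
structure StateSpace (n m p : ℕ) where
  A : Matrix (Fin n) (Fin n) ℝ
  B : Matrix (Fin n) (Fin m) ℝ
  C : Matrix (Fin p) (Fin n) ℝ
  D : Matrix (Fin p) (Fin m) ℝ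

/-- The transfer matrix `C (sI - A)⁻¹ B + D`. -/
def StateSpace.tf {n m p : ℕ} (S : StateSpace n m p) (s : ℂ) : Matrix (Fin p) (Fin m) ℂ :=
  toC S.C * (s • (1 : Matrix (Fin n) (Fin n) ℂ) - toC S.A)⁻¹ * toC S.B + toC S.D

/-- `S` realizes the rational matrix function `f`: both agree near infinity, hence as rational
functions. -/
def StateSpace.Realizes {n m p : ℕ} (S : StateSpace n m p) (f : ℂ → Matrix (Fin p) (Fin m) ℂ) :
    Prop :=
  ∀ᶠ s in cocompact ℂ, S.tf s = f s

/-- Asymptotic stability of a system matrix: all complex eigenvalues have negative real part. -/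
def AsympStable {n : ℕ} (A : Matrix (Fin n) (Fin n) ℝ) : Prop :=
  ∀ μ ∈ spectrum ℂ (toC A), μ.re < 0

/-- A single-input single-output feedback loop `e = r - y`, `q = K e`, `u = R q`, `y = G u` with a
linear controller `K`, a reset element `R` with base-linear part `R` and reset matrix `Arho`
(at a reset, the state `x` of `R` jumps to `Arho x`), and a linear system `G`. -/
structure Loop (nK nR nG : ℕ) where
  K : StateSpace nK 1 1
  R : StateSpace nR 1 1
  Arho : Matrix (Fin nR) (Fin nR) ℝ
  G : StateSpace nG 1 1

/-- The time-domain signals of a loop: the three states, and the signals `e`, `q`, `u`, `y`. -/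
structure Signals (nK nR nG : ℕ) where
  xK : ℝ → Fin nK → ℝ
  xR : ℝ → Fin nR → ℝ
  xG : ℝ → Fin nG → ℝ
  e : ℝ → Fin 1 → ℝ
  q : ℝ → Fin 1 → ℝ
  u : ℝ → Fin 1 → ℝ
  y : ℝ → Fin 1 → ℝ

namespace Loop

variable {nK nR nG : ℕ} (L : Loop nK nR nG)

/-- The algebraic loop through the direct feed-throughs is well posed. -/
def WellPosed : Prop :=
  IsUnit (1 + L.G.D * L.R.D * L.K.D)

/-- The output and interconnection equations of the loop with reference `r`. -/
def Interconnected (r : ℝ → ℝ) (w : Signals nK nR nG) : Prop :=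
  ∀ t, w.e t = (fun _ => r t) - w.y t ∧
    w.q t = L.K.C *ᵥ w.xK t + L.K.D *ᵥ w.e t ∧
    w.u t = L.R.C *ᵥ w.xR t + L.R.D *ᵥ w.q t ∧
    w.y t = L.G.C *ᵥ w.xG t + L.G.D *ᵥ w.u t

/-- The differential equations of the loop hold at time `t`. -/
def FlowsAt (w : Signals nK nR nG) (t : ℝ) : Prop :=
  HasDerivAt w.xK (L.K.A *ᵥ w.xK t + L.K.B *ᵥ w.e t) t ∧
    HasDerivAt w.xR (L.R.A *ᵥ w.xR t + L.R.B *ᵥ w.q t) t ∧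
    HasDerivAt w.xG (L.G.A *ᵥ w.xG t + L.G.B *ᵥ w.u t) t

/-- `w` is a response of the base-linear system (the loop without resets) to `r`. -/
structure IsBLSResponse (r : ℝ → ℝ) (w : Signals nK nR nG) : Prop where
  interconnected : L.Interconnected r w
  flows : ∀ t, L.FlowsAt w t

/-- The base-linear system is asymptotically stable: all unforced responses tend to zero. -/
def BLSStable : Prop :=
  ∀ w : Signals nK nR nG, L.IsBLSResponse (fun _ => 0) w →
    Tendsto w.xK atTop (𝓝 0) ∧ Tendsto w.xR atTop (𝓝 0) ∧ Tendsto w.xG atTop (𝓝 0)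

/-- `w` is a response of the reset loop to `r` with reset instants `T`. It flows outside `T`. At a
reset instant the value of a signal is its value just before the reset; there `q` is zero, and the
state of the reset element (and nothing else) jumps from `x` to `Arho x`. -/
structure IsResetResponse (r : ℝ → ℝ) (T : Set ℝ) (w : Signals nK nR nG) : Prop where
  interconnected : L.Interconnected r w
  flows : ∀ t ∉ T, L.FlowsAt w t
  continuousAt_xK : ∀ t ∈ T, ContinuousAt w.xK t
  continuousAt_xG : ∀ t ∈ T, ContinuousAt w.xG t
  left_xR : ∀ t ∈ T, ContinuousWithinAt w.xR (Set.Iic t) t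
  jump_xR : ∀ t ∈ T, Tendsto w.xR (𝓝[>] t) (𝓝 (L.Arho *ᵥ w.xR t))
  zero_q : ∀ t ∈ T, w.q t 0 = 0

/-- `R_L^X(s) = (sI - A_R)⁻¹ B_R`, from the input of the reset element to its state. -/
def RLX (s : ℂ) : Matrix (Fin nR) (Fin 1) ℂ :=
  (s • (1 : Matrix (Fin nR) (Fin nR) ℂ) - toC L.R.A)⁻¹ * toC L.R.B

/-- `R_δ^X(s) = (sI - A_R)⁻¹ (A_ρ - I)`, from the impulsive reset input to the state. -/
def RdX (s : ℂ) : Matrix (Fin nR) (Fin nR) ℂ :=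
  (s • (1 : Matrix (Fin nR) (Fin nR) ℂ) - toC L.R.A)⁻¹ * toC (L.Arho - 1)

/-- `R_δ(s) = C_R R_δ^X(s)`. -/
def Rd (s : ℂ) : Matrix (Fin 1) (Fin nR) ℂ :=
  toC L.R.C * L.RdX s

/-- The sensitivity `S_L(s) = (1 + G(s) R_L(s) K(s))⁻¹` of the base-linear system. -/
def SL (s : ℂ) : Matrix (Fin 1) (Fin 1) ℂ :=
  (1 + L.G.tf s * L.R.tf s * L.K.tf s)⁻¹

/-- `Q_δ(s) = K(s) S_L(s) G(s) R_δ(s)`. -/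
def Qd (s : ℂ) : Matrix (Fin 1) (Fin nR) ℂ :=
  L.K.tf s * L.SL s * L.G.tf s * L.Rd s

/-- `H(s) = R_δ^X(s) - R_L^X(s) K(s) S_L(s) G(s) R_δ(s)`. -/
def H (s : ℂ) : Matrix (Fin nR) (Fin nR) ℂ :=
  L.RdX s - L.RLX s * L.K.tf s * L.SL s * L.G.tf s * L.Rd s

/-- The magnitude `|K(jω) S_L(jω) R_I|`, where `R_I` is the phasor of the reference. -/
def blsMag (ω : ℝ) (RI : ℂ) : ℝ :=
  ‖(L.K.tf (ω * Complex.I) * L.SL (ω * Complex.I)) 0 0 * RI‖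

end Loop

/-- The sinusoid `|R_I| sin(ωt + ∠R_I)`. -/
def sinusoid (ω : ℝ) (RI : ℂ) (t : ℝ) : ℝ :=
  ‖RI‖ * Real.sin (ω * t + Complex.arg RI)

/-- All states are periodic with period `P`. -/
def Signals.StatesPeriodic {nK nR nG : ℕ} (w : Signals nK nR nG) (P : ℝ) : Prop :=
  Function.Periodic w.xK P ∧ Function.Periodic w.xR P ∧ Function.Periodic w.xG P

/-- The instants `tρ + p π / ω`, `p ∈ ℤ`. -/
def resetInstants (ω tρ : ℝ) : Set ℝ :=
  {t | ∃ p : ℤ, t = tρ + p * (Real.pi / ω)}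

/-- The impulse response `C exp(At) B` for `t > 0`. -/
def StateSpace.impulse {n m p : ℕ} (S : StateSpace n m p) (t : ℝ) : Matrix (Fin p) (Fin m) ℝ :=
  S.C * NormedSpace.exp (t • S.A) * S.B

/-- The summand `exp(A k π / ω) - exp(A (k - 1) π / ω)` for the even number `k = 2 (n + 1)`, so that
`k` runs through the positive even numbers as `n` runs through `ℕ`. -/
def seriesTerm {d : ℕ} (ω : ℝ) (A : Matrix (Fin d) (Fin d) ℝ) (n : ℕ) : Matrix (Fin d) (Fin d) ℝ :=
  NormedSpace.exp (((2 * ((n : ℝ) + 1)) * Real.pi / ω) • A) -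
    NormedSpace.exp (((2 * ((n : ℝ) + 1) - 1) * Real.pi / ω) • A)

/-- `C ∑ₖ (exp(A k π / ω) - exp(A (k - 1) π / ω)) B`, summed over positive even `k`. -/
def StateSpace.series {n m p : ℕ} (S : StateSpace n m p) (ω : ℝ) : Matrix (Fin p) (Fin m) ℝ :=
  S.C * (∑' k : ℕ, seriesTerm ω S.A k) * S.B

/-- The argument of `sin⁻¹` in the phase shift of the zero crossing for the reset state `x`, with
`M` the magnitude of the base-linear response. -/
def phaseArg {nR nQ : ℕ} (Q : StateSpace nQ nR 1) (ω M : ℝ) (x : Fin nR → ℝ) : ℝ :=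
  (Q.series ω *ᵥ x) 0 / M

/-- The phase shift `Φ(ω, x)` of the zero crossing. -/
def Phi {nR nQ : ℕ} (Q : StateSpace nQ nR 1) (ω M : ℝ) (x : Fin nR → ℝ) : ℝ :=
  Real.arcsin (phaseArg Q ω M x)

/-- The first-order Taylor polynomial of `f` at `0`. -/
def linearised {E : Type*} [NormedAddCommGroup E] [NormedSpace ℝ E] (f : ℝ → E) (φ : ℝ) : E :=
  f 0 + φ • deriv f 0

/-- The rotation `exp(j (π/2 - φ))`. -/
def phaseRotation (φ : ℝ) : ℂ :=
  Complex.exp (Complex.I * ((Real.pi / 2 - φ : ℝ) : ℂ))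

/-- The right-hand side of the state equation `x = x_L + x_δ` at a descending reset instant:
`Re{R_L^X(jω) M rot(asin(∙))} + C_H ∑ₖ (…) B_H x`. With `asin = Real.arcsin` and `rot = phaseRotation`
this is the exact equation; with their linearisations it is the linearised one. -/
def stateRHS {nK nR nG nQ nH : ℕ} (L : Loop nK nR nG) (Q : StateSpace nQ nR 1)
    (H : StateSpace nH nR nR) (ω M : ℝ) (asin : ℝ → ℝ) (rot : ℝ → ℂ) (x : Fin nR → ℝ) :
    Fin nR → ℝ :=
  (fun i => (L.RLX (ω * Complex.I) i 0 * (M : ℂ) * rot (asin (phaseArg Q ω M x))).re) +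
    H.series ω *ᵥ x

/-- `I + (ω²I + A_R²)⁻¹ A_R B_R C_Q ∑ₖ (…) B_Q - C_H ∑ₖ (…) B_H`. -/
def bracket {nK nR nG nQ nH : ℕ} (L : Loop nK nR nG) (Q : StateSpace nQ nR 1)
    (H : StateSpace nH nR nR) (ω : ℝ) : Matrix (Fin nR) (Fin nR) ℝ :=
  1 + (ω ^ 2 • (1 : Matrix (Fin nR) (Fin nR) ℝ) + L.R.A ^ 2)⁻¹ * L.R.A * L.R.B * Q.series ω -
    H.series ω

/-- The explicit formula for the reset state: the inverse of the bracket, applied to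
`(ω²I + A_R²)⁻¹ ω B_R M`. -/
def stateFormula {nK nR nG nQ nH : ℕ} (L : Loop nK nR nG) (Q : StateSpace nQ nR 1)
    (H : StateSpace nH nR nR) (ω M : ℝ) : Fin nR → ℝ :=
  ((bracket L Q H ω)⁻¹ *
    (ω ^ 2 • (1 : Matrix (Fin nR) (Fin nR) ℝ) + L.R.A ^ 2)⁻¹ * (ω • L.R.B)) *ᵥ (fun _ => M)

end ResetControl

end

open ResetControl

/-! Stack the three states into one vector with closed-loop matrix `clA`. Driven by the same
reference, the reset response and the base-linear response differ by an unforced solution. At each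
reset this deviation receives the jump `J x`, with `J = clJump` acting on the current reset state,
and between resets it flows by `clA`. With `E = exp((π/ω) clA)`, antisymmetry of the reset state and
`2π/ω`-periodicity give `δ = E² δ + E² J x - E J x` for the deviation `δ` at `tρ`. Iterating
telescopes, and `E^(2N) δ → 0` by stability, so `δ = ∑ (E^(2k+2) - E^(2k+1)) J x`.

The series in the claim use other realizations. Elimination in the frequency domain shows that
`clA`, `J` realize `-Q_δ` with output `q` and `H` with output `x_R`. Transfer functions that agree
near infinity have equal Markov parameters `C A^k B`, hence equal impulse responses. Therefore `Σ_Q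
x = -(q - q_L)(tρ)` and `Σ_H x = x - x_L(tρ)`. Convergence of the series themselves comes from
stability of `A_Q` and `A_H`: the exponential has spectral radius below one.

The periodic base-linear response is harmonic. Let `ζ` be the phasor of `q_L` turned to time `tρ`,
so `|ζ| = M`. As `q(tρ) = 0`, `Im ζ = Σ_Q x = M sin Φ`; the descending crossing forces `Re ζ < 0`.
Thus `ζ = j M exp(j(π/2 - Φ))`, and `x_L = Im(R_L^X ζ)` is the first term of the state equation.

Splitting `R_L^X(jω)` into real and imaginary parts turns the exact equation into `bracket x = cos Φ
· (ω²I + A_R²)⁻¹ ω B_R M`. Linearisation only replaces `cos Φ` by `1`. Hence `x = cos Φ · x̂`, and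
the error bound is `1 - cos Φ ≤ Φ²/2`. -/

noncomputable section

namespace ResetControl

/-! ### Real matrices viewed over the complex numbers -/

section Complexification

variable {ι κ l : Type*}

/-- A real matrix with arbitrary index types regarded as a complex one. -/
def cplx (M : Matrix ι κ ℝ) : Matrix ι κ ℂ :=
  M.map (fun x : ℝ => (x : ℂ))

theorem toC_eq_cplx {a b : ℕ} (M : Matrix (Fin a) (Fin b) ℝ) : toC M = cplx M := rfl

theorem cplx_apply (M : Matrix ι κ ℝ) (i : ι) (j : κ) : cplx M i j = (M i j : ℂ) := rfl

theorem cplx_injective : Function.Injective (cplx : Matrix ι κ ℝ → Matrix ι κ ℂ) :=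
  fun M N h => by
    ext i j
    have := congr_fun (congr_fun h i) j
    simpa [cplx_apply] using this

theorem cplx_mul [Fintype κ] (M : Matrix ι κ ℝ) (N : Matrix κ l ℝ) :
    cplx (M * N) = cplx M * cplx N := by
  ext i j
  simp [cplx_apply, Matrix.mul_apply]

theorem cplx_add (M N : Matrix ι κ ℝ) : cplx (M + N) = cplx M + cplx N := by
  ext i j
  simp [cplx_apply]

theorem cplx_neg (M : Matrix ι κ ℝ) : cplx (-M) = -cplx M := by
  ext i j
  simp [cplx_apply]

theorem cplx_zero : cplx (0 : Matrix ι κ ℝ) = 0 := by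
  ext i j
  simp [cplx_apply]

theorem cplx_smul (c : ℝ) (M : Matrix ι κ ℝ) : cplx (c • M) = (c : ℂ) • cplx M := by
  ext i j
  simp [cplx_apply]

theorem cplx_one [DecidableEq ι] : cplx (1 : Matrix ι ι ℝ) = 1 := by
  ext i j
  by_cases h : i = j <;> simp [cplx_apply, Matrix.one_apply, h]

theorem cplx_pow [Fintype ι] [DecidableEq ι] (M : Matrix ι ι ℝ) (k : ℕ) :
    cplx (M ^ k) = cplx M ^ k := by
  induction k with
  | zero => simp [cplx_one]
  | succ k ih => rw [pow_succ, cplx_mul, ih, pow_succ]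

theorem re_cplx_mulVec [Fintype κ] (M : Matrix ι κ ℝ) (z : κ → ℂ) :
    (fun i => ((cplx M *ᵥ z) i).re) = M *ᵥ fun j => (z j).re := by
  ext i
  simp [Matrix.mulVec, dotProduct, cplx_apply]

theorem im_cplx_mulVec [Fintype κ] (M : Matrix ι κ ℝ) (z : κ → ℂ) :
    (fun i => ((cplx M *ᵥ z) i).im) = M *ᵥ fun j => (z j).im := by
  ext i
  simp [Matrix.mulVec, dotProduct, cplx_apply]

end Complexification

/-! ### Transfer functions near infinity and Markov parameters -/

section Markov

variable {ι ι' : Type*} [Fintype ι] [DecidableEq ι] [Fintype ι'] [DecidableEq ι'] {m p : Type*}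

theorem eventually_isUnit_smul_one_sub (A : Matrix ι ι ℂ) :
    ∀ᶠ s in cocompact ℂ, IsUnit (s • (1 : Matrix ι ι ℂ) - A) := by
  have h : ∀ᶠ z in cocompact ℂ, IsUnit (resolvent A z) := by
    open scoped Matrix.Norms.Operator in
    rw [← Metric.cobounded_eq_cocompact]
    exact spectrum.eventually_isUnit_resolvent A
  filter_upwards [h] with s hs
  rw [← Algebra.algebraMap_eq_smul_one]
  exact spectrum.mem_resolventSet_iff.1 (spectrum.isUnit_resolvent.2 hs)

theorem tendsto_inv_smul_one_sub (A : Matrix ι ι ℂ) :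
    Tendsto (fun s : ℂ => (s • (1 : Matrix ι ι ℂ) - A)⁻¹) (cocompact ℂ) (𝓝 0) := by
  have h : Tendsto (resolvent A) (cocompact ℂ) (𝓝 0) := by
    open scoped Matrix.Norms.Operator in
    rw [← Metric.cobounded_eq_cocompact]
    exact spectrum.resolvent_tendsto_cobounded A
  refine h.congr fun s => ?_
  rw [resolvent, Algebra.algebraMap_eq_smul_one, nonsing_inv_eq_ringInverse]

theorem tendsto_transfer (C : Matrix p ι ℂ) (A : Matrix ι ι ℂ) (B : Matrix ι m ℂ) :
    Tendsto (fun s : ℂ => C * (s • (1 : Matrix ι ι ℂ) - A)⁻¹ * B) (cocompact ℂ) (𝓝 0) := by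
  have hc : Continuous fun M : Matrix ι ι ℂ => C * M * B :=
    (continuous_const.matrix_mul continuous_id).matrix_mul continuous_const
  have h := (hc.tendsto 0).comp (tendsto_inv_smul_one_sub A)
  simp only [Matrix.mul_zero, Matrix.zero_mul] at h
  exact h

theorem smul_inv_smul_one_sub {A : Matrix ι ι ℂ} {s : ℂ}
    (hs : IsUnit (s • (1 : Matrix ι ι ℂ) - A)) :
    s • (s • (1 : Matrix ι ι ℂ) - A)⁻¹ = 1 + A * (s • (1 : Matrix ι ι ℂ) - A)⁻¹ := by
  have h := Matrix.mul_nonsing_inv _ ((Matrix.isUnit_iff_isUnit_det _).1 hs)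
  rw [sub_mul, smul_mul_assoc, one_mul] at h
  exact (sub_eq_iff_eq_add.1 h)

theorem smul_transfer {C : Matrix p ι ℂ} {A : Matrix ι ι ℂ} {B : Matrix ι m ℂ} {s : ℂ}
    (hs : IsUnit (s • (1 : Matrix ι ι ℂ) - A)) :
    s • (C * (s • (1 : Matrix ι ι ℂ) - A)⁻¹ * B) =
      C * B + C * A * (s • (1 : Matrix ι ι ℂ) - A)⁻¹ * B := by
  rw [← Matrix.smul_mul, ← Matrix.mul_smul, smul_inv_smul_one_sub hs, Matrix.mul_add,
    Matrix.add_mul, Matrix.mul_one, Matrix.mul_assoc C A]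

/-- The resolvent tends to zero at infinity, so each feed-through is the limit of its transfer
function there. -/
theorem feedthrough_eq {C : Matrix p ι ℂ} {A : Matrix ι ι ℂ} {B : Matrix ι m ℂ} {D : Matrix p m ℂ}
    {C' : Matrix p ι' ℂ} {A' : Matrix ι' ι' ℂ} {B' : Matrix ι' m ℂ} {D' : Matrix p m ℂ}
    (h : ∀ᶠ s in cocompact ℂ, C * (s • (1 : Matrix ι ι ℂ) - A)⁻¹ * B + D =
      C' * (s • (1 : Matrix ι' ι' ℂ) - A')⁻¹ * B' + D') : D = D' := by
  have h1 := (tendsto_transfer C A B).add_const D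
  have h2 := (tendsto_transfer C' A' B').add_const D'
  rw [zero_add] at h1 h2
  exact tendsto_nhds_unique (h1.congr' h) h2

/-- Transfer functions which agree near infinity have the same Markov parameters. -/
theorem markov_eq {C : Matrix p ι ℂ} {A : Matrix ι ι ℂ} {B : Matrix ι m ℂ}
    {C' : Matrix p ι' ℂ} {A' : Matrix ι' ι' ℂ} {B' : Matrix ι' m ℂ}
    (h : ∀ᶠ s in cocompact ℂ, C * (s • (1 : Matrix ι ι ℂ) - A)⁻¹ * B =
      C' * (s • (1 : Matrix ι' ι' ℂ) - A')⁻¹ * B') (k : ℕ) :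
    C * A ^ k * B = C' * A' ^ k * B' := by
  suffices H : (∀ᶠ s in cocompact ℂ, C * A ^ k * (s • (1 : Matrix ι ι ℂ) - A)⁻¹ * B =
      C' * A' ^ k * (s • (1 : Matrix ι' ι' ℂ) - A')⁻¹ * B') ∧
      C * A ^ k * B = C' * A' ^ k * B' from H.2
  have step : ∀ j : ℕ, (∀ᶠ s in cocompact ℂ, C * A ^ j * (s • (1 : Matrix ι ι ℂ) - A)⁻¹ * B =
      C' * A' ^ j * (s • (1 : Matrix ι' ι' ℂ) - A')⁻¹ * B') →
      (∀ᶠ s in cocompact ℂ, C * A ^ (j + 1) * (s • (1 : Matrix ι ι ℂ) - A)⁻¹ * B =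
      C' * A' ^ (j + 1) * (s • (1 : Matrix ι' ι' ℂ) - A')⁻¹ * B') ∧
      C * A ^ j * B = C' * A' ^ j * B' := by
    intro j hj
    -- Multiplication by `s` shifts the expansion at infinity by one place: the next Markov
    -- parameter becomes the feed-through, and the strictly proper remainders agree again.
    have e : ∀ᶠ s in cocompact ℂ,
        C * A ^ (j + 1) * (s • (1 : Matrix ι ι ℂ) - A)⁻¹ * B + C * A ^ j * B =
        C' * A' ^ (j + 1) * (s • (1 : Matrix ι' ι' ℂ) - A')⁻¹ * B' + C' * A' ^ j * B' := by
      filter_upwards [hj, eventually_isUnit_smul_one_sub A, eventually_isUnit_smul_one_sub A']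
        with s h1 h2 h3
      have := congr_arg (fun M => s • M) h1
      simp only [smul_transfer h2, smul_transfer h3] at this
      rw [pow_succ, pow_succ, ← Matrix.mul_assoc, ← Matrix.mul_assoc, add_comm, this, add_comm]
    have hD := feedthrough_eq e
    refine ⟨?_, hD⟩
    filter_upwards [e] with s hs
    rw [hD] at hs
    exact add_right_cancel hs
  have all : ∀ j : ℕ, ∀ᶠ s in cocompact ℂ, C * A ^ j * (s • (1 : Matrix ι ι ℂ) - A)⁻¹ * B =
      C' * A' ^ j * (s • (1 : Matrix ι' ι' ℂ) - A')⁻¹ * B' := by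
    intro j
    induction j with
    | zero => simpa using h
    | succ j ih => exact (step j ih).1
  exact ⟨all k, (step k (all k)).2⟩

end Markov

/-! ### Matrix exponentials: equality, convergence and linear flows -/

section Exponential

variable {ι ι' : Type*} [Fintype ι] [DecidableEq ι] [Fintype ι'] [DecidableEq ι'] {m p : Type*}

theorem hasSum_matrix_exp {𝕜 : Type*} [RCLike 𝕜] (A : Matrix ι ι 𝕜) :
    HasSum (fun k : ℕ => ((k.factorial : 𝕜)⁻¹) • A ^ k) (NormedSpace.exp A) := by
  open scoped Matrix.Norms.Operator in
  exact NormedSpace.exp_series_hasSum_exp' A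

theorem hasSum_sandwich_exp (C : Matrix p ι ℝ) (A : Matrix ι ι ℝ) (B : Matrix ι m ℝ) (t : ℝ) :
    HasSum (fun k : ℕ => ((k.factorial : ℝ)⁻¹ * t ^ k) • (C * A ^ k * B))
      (C * NormedSpace.exp (t • A) * B) := by
  let f : Matrix ι ι ℝ →+ Matrix p m ℝ :=
    { toFun := fun M => C * M * B
      map_zero' := by simp
      map_add' := fun M N => by rw [Matrix.mul_add, Matrix.add_mul] }
  have hf : Continuous f := (continuous_const.matrix_mul continuous_id).matrix_mul continuous_const
  refine ((hasSum_matrix_exp (t • A)).map f hf).congr_fun fun k => ?_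
  change _ = C * (((k.factorial : ℝ)⁻¹) • (t • A) ^ k) * B
  rw [smul_pow, smul_smul, Matrix.mul_smul, Matrix.smul_mul]

/-- The Markov parameters are, up to factorials, the Taylor coefficients of the impulse response in
`t`. -/
theorem exp_eq_of_markov_eq {C : Matrix p ι ℝ} {A : Matrix ι ι ℝ} {B : Matrix ι m ℝ}
    {C' : Matrix p ι' ℝ} {A' : Matrix ι' ι' ℝ} {B' : Matrix ι' m ℝ}
    (h : ∀ k : ℕ, C * A ^ k * B = C' * A' ^ k * B') (t : ℝ) :
    C * NormedSpace.exp (t • A) * B = C' * NormedSpace.exp (t • A') * B' := by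
  have h1 := hasSum_sandwich_exp C A B t
  simp only [h] at h1
  exact h1.unique (hasSum_sandwich_exp C' A' B' t)

theorem exp_mulVec_of_eigenvector {A : Matrix ι ι ℂ} {μ : ℂ} {v : ι → ℂ} (h : A *ᵥ v = μ • v) :
    NormedSpace.exp A *ᵥ v = Complex.exp μ • v := by
  have hp : ∀ k : ℕ, A ^ k *ᵥ v = μ ^ k • v := by
    intro k
    induction k with
    | zero => simp
    | succ k ih => rw [pow_succ, ← Matrix.mulVec_mulVec, h, Matrix.mulVec_smul, ih, smul_smul,
        pow_succ, mul_comm]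
  let f : Matrix ι ι ℂ →+ (ι → ℂ) :=
    { toFun := fun M => M *ᵥ v
      map_zero' := by simp
      map_add' := fun M N => Matrix.add_mulVec M N v }
  have hf : Continuous f := continuous_id.matrix_mulVec continuous_const
  have h1 := (hasSum_matrix_exp A).map f hf
  have h2 : HasSum (fun k : ℕ => ((k.factorial : ℂ)⁻¹ • μ ^ k) • v) (Complex.exp μ • v) := by
    rw [Complex.exp_eq_exp_ℂ]
    exact (NormedSpace.exp_series_hasSum_exp' μ).smul_const v
  refine h1.unique (h2.congr_fun fun k => ?_)
  change (((k.factorial : ℂ)⁻¹) • A ^ k) *ᵥ v = _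
  rw [Matrix.smul_mulVec, hp, smul_smul, smul_eq_mul]

theorem cplx_exp (A : Matrix ι ι ℝ) : cplx (NormedSpace.exp A) = NormedSpace.exp (cplx A) := by
  let f : Matrix ι ι ℝ →+ Matrix ι ι ℂ :=
    { toFun := cplx
      map_zero' := cplx_zero
      map_add' := cplx_add }
  have hf : Continuous f := continuous_id.matrix_map Complex.continuous_ofReal
  refine ((hasSum_matrix_exp A).map f hf).unique ((hasSum_matrix_exp (cplx A)).congr_fun
    fun k => ?_)
  change cplx (((k.factorial : ℝ)⁻¹) • A ^ k) = _
  rw [cplx_smul, cplx_pow]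
  push_cast
  rfl

/-- `A` commutes with its exponential, so it preserves the `z`-eigenspace of the latter and has an
eigenvector there. On that vector the exponential acts both as `z` and as `exp μ`. -/
theorem exists_eq_exp_of_mem_spectrum_exp {A : Matrix ι ι ℂ} {z : ℂ}
    (hz : z ∈ spectrum ℂ (NormedSpace.exp A)) : ∃ μ ∈ spectrum ℂ A, z = Complex.exp μ := by
  rw [← Matrix.spectrum_toLin', ← Module.End.hasEigenvalue_iff_mem_spectrum] at hz
  have hcomm : Commute (toLin' (NormedSpace.exp A)) (toLin' A) := by
    have : Commute (NormedSpace.exp A) A := (Commute.refl A).exp_left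
    change toLin' _ ∘ₗ toLin' _ = toLin' _ ∘ₗ toLin' _
    rw [← Matrix.toLin'_mul, ← Matrix.toLin'_mul, this.eq]
  have hmaps : ∀ v ∈ Module.End.eigenspace (toLin' (NormedSpace.exp A)) z,
      toLin' A v ∈ Module.End.eigenspace (toLin' (NormedSpace.exp A)) z :=
    fun v hv => Module.End.mapsTo_genEigenspace_of_comm hcomm z 1 hv
  have : Nontrivial (Module.End.eigenspace (toLin' (NormedSpace.exp A)) z) :=
    Submodule.nontrivial_iff_ne_bot.2 hz
  obtain ⟨μ, hμ⟩ := Module.End.exists_eigenvalue ((toLin' A).restrict hmaps)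
  obtain ⟨⟨v, hv⟩, hv1, hv0⟩ := hμ.exists_hasEigenvector
  have hv0' : v ≠ 0 := fun h => hv0 (Subtype.ext h)
  have hAv : A *ᵥ v = μ • v := by
    have := congr_arg Subtype.val (Module.End.mem_eigenspace_iff.1 hv1)
    simpa using this
  have hEv : NormedSpace.exp A *ᵥ v = z • v := by
    simpa using Module.End.mem_eigenspace_iff.1 hv
  refine ⟨μ, ?_, ?_⟩
  · rw [← Matrix.spectrum_toLin', ← Module.End.hasEigenvalue_iff_mem_spectrum]
    refine Module.End.hasEigenvalue_of_hasEigenvector (x := v) ⟨?_, hv0'⟩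
    rw [Module.End.mem_eigenspace_iff]
    simpa using hAv
  · rw [exp_mulVec_of_eigenvector hAv] at hEv
    exact (smul_left_injective ℂ hv0' hEv).symm

/-- The spectral radius is below one; by Gelfand's formula the powers are eventually dominated by a
geometric sequence. -/
theorem summable_pow_of_spectrum_lt_one {E : Matrix ι ι ℂ} (h : ∀ z ∈ spectrum ℂ E, ‖z‖ < 1) :
    Summable fun k : ℕ => E ^ k := by
  rcases isEmpty_or_nonempty ι with hι | hι
  · have : (fun k : ℕ => E ^ k) = 0 := by
      ext k i
      exact hι.elim i
    rw [this]
    exact summable_zero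
  open scoped Matrix.Norms.Operator in
  have hr : spectralRadius ℂ E < 1 := by
    exact_mod_cast spectrum.spectralRadius_lt_of_forall_lt E (r := 1)
      fun z hz => by simpa [← NNReal.coe_lt_coe] using h z hz
  obtain ⟨r, hr1, hr2⟩ := ENNReal.lt_iff_exists_nnreal_btwn.1 hr
  have hr2' : (r : ℝ) < 1 := by exact_mod_cast hr2
  have hev := (spectrum.pow_nnnorm_pow_one_div_tendsto_nhds_spectralRadius E).eventually
    (gt_mem_nhds hr1)
  refine Summable.of_norm_bounded_eventually_nat
    (summable_geometric_of_lt_one r.coe_nonneg hr2') ?_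
  filter_upwards [hev, eventually_gt_atTop 0] with n hn hn0
  have hn' : (0 : ℝ) < n := by exact_mod_cast hn0
  rw [one_div, ENNReal.rpow_inv_lt_iff hn', ENNReal.rpow_natCast] at hn
  exact_mod_cast hn.le

/-- An eigenvalue of `exp(hA)` is `exp(μ)` with `μ/h` in the spectrum of `A`, so its modulus is
below one. Taking real parts brings the complex sum back to the real matrices. -/
theorem summable_exp_pow {n : ℕ} {A : Matrix (Fin n) (Fin n) ℝ} (hA : AsympStable A) {h : ℝ}
    (hh : 0 < h) : Summable fun k : ℕ => NormedSpace.exp (h • A) ^ k := by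
  have hs : Summable fun k : ℕ => NormedSpace.exp (cplx (h • A)) ^ k := by
    refine summable_pow_of_spectrum_lt_one fun z hz => ?_
    obtain ⟨μ, hμ, rfl⟩ := exists_eq_exp_of_mem_spectrum_exp hz
    rw [cplx_smul] at hμ
    have hne : (h : ℂ) ≠ 0 := by exact_mod_cast hh.ne'
    have hμ' : (h : ℂ)⁻¹ * μ ∈ spectrum ℂ (cplx A) := by
      have := spectrum.smul_mem_smul_iff (s := (h : ℂ)⁻¹ * μ) (a := cplx A) (r := Units.mk0 _ hne)
      rw [← this]
      simpa [Units.smul_def, hne] using hμ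
    have h1 := hA _ hμ'
    rw [← Complex.ofReal_inv, Complex.re_ofReal_mul] at h1
    have h2 : μ.re < 0 := by
      by_contra hc
      exact absurd h1 (not_lt.2 (mul_nonneg (inv_nonneg.2 hh.le) (not_lt.1 hc)))
    rw [Complex.norm_exp]
    exact (Real.exp_lt_exp.2 h2).trans_eq Real.exp_zero
  let f : Matrix (Fin n) (Fin n) ℂ →+ Matrix (Fin n) (Fin n) ℝ :=
    { toFun := fun M => M.map Complex.re
      map_zero' := by ext; simp
      map_add' := fun M N => by ext; simp }
  have hf : Continuous f := continuous_id.matrix_map Complex.continuous_re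
  refine (hs.map f hf).congr fun k => ?_
  change (NormedSpace.exp (cplx (h • A)) ^ k).map Complex.re = _
  rw [← cplx_exp, ← cplx_pow]
  ext i j
  rfl

theorem seriesTerm_eq {n : ℕ} (ω : ℝ) (A : Matrix (Fin n) (Fin n) ℝ) (k : ℕ) :
    seriesTerm ω A k = NormedSpace.exp ((Real.pi / ω) • A) ^ (2 * k + 2) -
      NormedSpace.exp ((Real.pi / ω) • A) ^ (2 * k + 1) := by
  rw [seriesTerm, ← Matrix.exp_nsmul, ← Matrix.exp_nsmul, ← Nat.cast_smul_eq_nsmul ℝ,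
    ← Nat.cast_smul_eq_nsmul ℝ, smul_smul, smul_smul]
  congr 3 <;> push_cast <;> ring_nf

theorem summable_seriesTerm {n : ℕ} {A : Matrix (Fin n) (Fin n) ℝ} (hA : AsympStable A) {ω : ℝ}
    (hω : 0 < ω) : Summable (seriesTerm ω A) := by
  have hs := summable_exp_pow hA (div_pos Real.pi_pos hω)
  refine ((hs.comp_injective (i := fun k : ℕ => 2 * k + 2) fun a b hab => ?_).sub
    (hs.comp_injective (i := fun k : ℕ => 2 * k + 1) fun a b hab => ?_)).congr
    fun k => ?_
  · simp only at hab; omega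
  · simp only at hab; omega
  · exact (seriesTerm_eq ω A k).symm

theorem hasDerivAt_exp_smul_mulVec (A : Matrix ι ι ℝ) (c : ι → ℝ) (t : ℝ) :
    HasDerivAt (fun s : ℝ => NormedSpace.exp (s • A) *ᵥ c)
      (A *ᵥ (NormedSpace.exp (t • A) *ᵥ c)) t := by
  have h : ∀ i j, HasDerivAt (fun s : ℝ => NormedSpace.exp (s • A) i j)
      ((A * NormedSpace.exp (t • A)) i j) t := by
    open scoped Matrix.Norms.Operator in
    exact fun i j => hasDerivAt_pi.1 (hasDerivAt_pi.1 (hasDerivAt_exp_smul_const' A t) i) j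
  rw [Matrix.mulVec_mulVec]
  exact hasDerivAt_pi.2 fun i => HasDerivAt.fun_sum fun j _ => (h i j).mul_const (c j)

/-- The variation of a solution of `Z' = A Z` across an interval, in terms of its one-sided limits
at the end points. -/
theorem flow_across {A : Matrix ι ι ℝ} {Z : ℝ → ι → ℝ} {a b : ℝ} (hab : a < b)
    (hd : ∀ t ∈ Set.Ioo a b, HasDerivAt Z (A *ᵥ Z t) t) {z₀ z₁ : ι → ℝ}
    (h₀ : Tendsto Z (𝓝[>] a) (𝓝 z₀)) (h₁ : Tendsto Z (𝓝[<] b) (𝓝 z₁)) :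
    z₁ = NormedSpace.exp ((b - a) • A) *ᵥ z₀ := by
  have hE : ∀ t i j, HasDerivAt (fun s : ℝ => NormedSpace.exp (s • A) i j)
      ((NormedSpace.exp (t • A) * A) i j) t := by
    open scoped Matrix.Norms.Operator in
    exact fun t i j => hasDerivAt_pi.1 (hasDerivAt_pi.1 (hasDerivAt_exp_smul_const A t) i) j
  have hEc : ∀ i j, Continuous fun s : ℝ => NormedSpace.exp (s • A) i j := fun i j =>
    continuous_iff_continuousAt.2 fun t => (hE t i j).continuousAt
  have hEc' : Continuous fun s : ℝ => NormedSpace.exp (s • A) :=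
    continuous_pi fun i => continuous_pi fun j => hEc i j
  -- Integrating factor: `exp((b - t)A) Z t` is constant on the open interval, and its limits at the
  -- two ends are the two sides of the claim.
  let g : ℝ → ι → ℝ := fun t => NormedSpace.exp ((b - t) • A) *ᵥ Z t
  have hg : ∀ t ∈ Set.Ioo a b, HasDerivAt g 0 t := by
    intro t ht
    have hE' : ∀ i j, HasDerivAt (fun s : ℝ => NormedSpace.exp ((b - s) • A) i j)
        ((NormedSpace.exp ((b - t) • A) * A) i j * (-1)) t := fun i j =>
      (hE (b - t) i j).comp t ((hasDerivAt_id t).const_sub b)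
    refine hasDerivAt_pi.2 fun i => ?_
    have := HasDerivAt.fun_sum (u := Finset.univ) fun j _ =>
      (hE' i j).mul (hasDerivAt_pi.1 (hd t ht) j)
    refine this.congr_deriv ?_
    rw [Finset.sum_add_distrib]
    have e1 : ∑ j, NormedSpace.exp ((b - t) • A) i j * (A *ᵥ Z t) j =
        ∑ j, (NormedSpace.exp ((b - t) • A) * A) i j * Z t j := by
      change (NormedSpace.exp ((b - t) • A) *ᵥ (A *ᵥ Z t)) i =
        ((NormedSpace.exp ((b - t) • A) * A) *ᵥ Z t) i
      rw [Matrix.mulVec_mulVec]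
    rw [e1, ← Finset.sum_add_distrib]
    exact Finset.sum_eq_zero fun j _ => by ring
  obtain ⟨c, hc⟩ := isOpen_Ioo.exists_is_const_of_deriv_eq_zero isPreconnected_Ioo
    (fun t ht => (hg t ht).differentiableAt.differentiableWithinAt) (fun t ht => (hg t ht).deriv)
  have lim : ∀ {l : Filter ℝ} {x : ℝ} {z : ι → ℝ}, l.NeBot → l ≤ 𝓝 x → Tendsto Z l (𝓝 z) →
      (∀ᶠ t in l, t ∈ Set.Ioo a b) → NormedSpace.exp ((b - x) • A) *ᵥ z = c := by
    intro l x z hl hlx hz hev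
    have hEx : Tendsto (fun t : ℝ => NormedSpace.exp ((b - t) • A)) l
        (𝓝 (NormedSpace.exp ((b - x) • A))) :=
      ((hEc'.comp (continuous_const.sub continuous_id)).tendsto x).mono_left hlx
    have hmv : Continuous fun q : Matrix ι ι ℝ × (ι → ℝ) => q.1 *ᵥ q.2 :=
      continuous_fst.matrix_mulVec continuous_snd
    have h1 : Tendsto g l (𝓝 (NormedSpace.exp ((b - x) • A) *ᵥ z)) :=
      (hmv.tendsto (NormedSpace.exp ((b - x) • A), z)).comp (hEx.prodMk_nhds hz)
    refine tendsto_nhds_unique h1 (tendsto_const_nhds.congr' ?_)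
    filter_upwards [hev] with t ht
    exact (hc t ht).symm
  have e0 := lim inferInstance nhdsWithin_le_nhds h₀ (Ioo_mem_nhdsGT hab)
  have e1 := lim inferInstance nhdsWithin_le_nhds h₁ (Ioo_mem_nhdsLT hab)
  rw [e0, ← e1]
  simp

end Exponential

/-- The joint state of the loop. -/
def stack {F : Type*} {nK nR nG : ℕ} (xK : Fin nK → F) (xR : Fin nR → F) (xG : Fin nG → F) :
    Fin nK ⊕ Fin nR ⊕ Fin nG → F :=
  Sum.elim xK (Sum.elim xR xG)

/-! ### The unforced loop as one linear system on the joint state -/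

namespace Loop

variable {nK nR nG : ℕ} (L : Loop nK nR nG)

/-- The part of the joint state that belongs to the controller. -/
def projK (nK nR nG : ℕ) : (Fin nK ⊕ Fin nR ⊕ Fin nG → ℝ) →ₗ[ℝ] (Fin nK → ℝ) :=
  LinearMap.funLeft ℝ ℝ Sum.inl

/-- The part of the joint state that belongs to the reset element. -/
def projR (nK nR nG : ℕ) : (Fin nK ⊕ Fin nR ⊕ Fin nG → ℝ) →ₗ[ℝ] (Fin nR → ℝ) :=
  LinearMap.funLeft ℝ ℝ (Sum.inr ∘ Sum.inl)

/-- The part of the joint state that belongs to the plant. -/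
def projG (nK nR nG : ℕ) : (Fin nK ⊕ Fin nR ⊕ Fin nG → ℝ) →ₗ[ℝ] (Fin nG → ℝ) :=
  LinearMap.funLeft ℝ ℝ (Sum.inr ∘ Sum.inr)

/-- The signal `e` of the unforced loop as a function of the joint state. -/
def outE : (Fin nK ⊕ Fin nR ⊕ Fin nG → ℝ) →ₗ[ℝ] (Fin 1 → ℝ) :=
  -((1 + L.G.D * L.R.D * L.K.D)⁻¹.mulVecLin ∘ₗ (L.G.C.mulVecLin ∘ₗ projG nK nR nG +
    L.G.D.mulVecLin ∘ₗ (L.R.C.mulVecLin ∘ₗ projR nK nR nG +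
      L.R.D.mulVecLin ∘ₗ L.K.C.mulVecLin ∘ₗ projK nK nR nG)))

/-- The signal `q` of the unforced loop as a function of the joint state. -/
def outQ : (Fin nK ⊕ Fin nR ⊕ Fin nG → ℝ) →ₗ[ℝ] (Fin 1 → ℝ) :=
  L.K.C.mulVecLin ∘ₗ projK nK nR nG + L.K.D.mulVecLin ∘ₗ L.outE

/-- The signal `u` of the unforced loop as a function of the joint state. -/
def outU : (Fin nK ⊕ Fin nR ⊕ Fin nG → ℝ) →ₗ[ℝ] (Fin 1 → ℝ) :=
  L.R.C.mulVecLin ∘ₗ projR nK nR nG + L.R.D.mulVecLin ∘ₗ L.outQ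

/-- The vector field of the unforced loop without resets. -/
def field : (Fin nK ⊕ Fin nR ⊕ Fin nG → ℝ) →ₗ[ℝ] (Fin nK ⊕ Fin nR ⊕ Fin nG → ℝ) where
  toFun X := stack (L.K.A *ᵥ projK nK nR nG X + L.K.B *ᵥ L.outE X)
    (L.R.A *ᵥ projR nK nR nG X + L.R.B *ᵥ L.outQ X)
    (L.G.A *ᵥ projG nK nR nG X + L.G.B *ᵥ L.outU X)
  map_add' X Y := by
    ext (i | i | i) <;> simp [stack, Matrix.mulVec_add] <;> ring
  map_smul' c X := by
    ext (i | i | i) <;> simp [stack, Matrix.mulVec_smul] <;> ring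

/-- The system matrix of the closed loop without resets. -/
def clA : Matrix (Fin nK ⊕ Fin nR ⊕ Fin nG) (Fin nK ⊕ Fin nR ⊕ Fin nG) ℝ :=
  LinearMap.toMatrix' L.field

/-- The output matrix of the closed loop for the signal `q`. -/
def clQ : Matrix (Fin 1) (Fin nK ⊕ Fin nR ⊕ Fin nG) ℝ :=
  LinearMap.toMatrix' L.outQ

/-- The output matrix for the state of the reset element. -/
def selR (nK nR nG : ℕ) : Matrix (Fin nR) (Fin nK ⊕ Fin nR ⊕ Fin nG) ℝ :=
  (1 : Matrix (Fin nK ⊕ Fin nR ⊕ Fin nG) (Fin nK ⊕ Fin nR ⊕ Fin nG) ℝ).submatrix (Sum.inr ∘ Sum.inl) id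

/-- The jump of the joint state, as a function of the state of the reset element. -/
def clJump : Matrix (Fin nK ⊕ Fin nR ⊕ Fin nG) (Fin nR) ℝ :=
  Matrix.of (Sum.elim (fun _ => 0) (Sum.elim (fun i => (L.Arho - 1) i) fun _ => 0))

variable {L}

/-- Eliminating `y`, `u` and `q` leaves an equation for `e` with coefficient `1 + D_G D_R D_K`,
which well-posedness inverts. The formulas for `clQ` and `clA` rest on this. -/
theorem outE_stack (hwp : L.WellPosed) {xK : Fin nK → ℝ} {xR : Fin nR → ℝ} {xG : Fin nG → ℝ}
    {e q u y : Fin 1 → ℝ} (he : e = -y) (hq : q = L.K.C *ᵥ xK + L.K.D *ᵥ e)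
    (hu : u = L.R.C *ᵥ xR + L.R.D *ᵥ q) (hy : y = L.G.C *ᵥ xG + L.G.D *ᵥ u) :
    L.outE (stack xK xR xG) = e := by
  have h : (1 + L.G.D * L.R.D * L.K.D) *ᵥ e =
      -(L.G.C *ᵥ xG + L.G.D *ᵥ (L.R.C *ᵥ xR + L.R.D *ᵥ (L.K.C *ᵥ xK))) := by
    rw [Matrix.add_mulVec, Matrix.one_mulVec, ← Matrix.mulVec_mulVec, ← Matrix.mulVec_mulVec]
    nth_rewrite 1 [he]
    rw [hy, hu, hq]
    simp only [Matrix.mulVec_add]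
    abel
  have hinv := Matrix.nonsing_inv_mul _ ((Matrix.isUnit_iff_isUnit_det _).1 hwp)
  change -((1 + L.G.D * L.R.D * L.K.D)⁻¹ *ᵥ
    (L.G.C *ᵥ xG + L.G.D *ᵥ (L.R.C *ᵥ xR + L.R.D *ᵥ (L.K.C *ᵥ xK)))) = e
  rw [← Matrix.mulVec_neg, ← h, Matrix.mulVec_mulVec, hinv, Matrix.one_mulVec]

theorem clQ_mulVec_stack (hwp : L.WellPosed) {xK : Fin nK → ℝ} {xR : Fin nR → ℝ} {xG : Fin nG → ℝ}
    {e q u y : Fin 1 → ℝ} (he : e = -y) (hq : q = L.K.C *ᵥ xK + L.K.D *ᵥ e)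
    (hu : u = L.R.C *ᵥ xR + L.R.D *ᵥ q) (hy : y = L.G.C *ᵥ xG + L.G.D *ᵥ u) :
    L.clQ *ᵥ stack xK xR xG = q := by
  rw [clQ, LinearMap.toMatrix'_mulVec]
  change L.K.C *ᵥ xK + L.K.D *ᵥ L.outE (stack xK xR xG) = q
  rw [outE_stack hwp he hq hu hy, hq]

theorem clA_mulVec_stack (hwp : L.WellPosed) {xK : Fin nK → ℝ} {xR : Fin nR → ℝ} {xG : Fin nG → ℝ}
    {e q u y : Fin 1 → ℝ} (he : e = -y) (hq : q = L.K.C *ᵥ xK + L.K.D *ᵥ e)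
    (hu : u = L.R.C *ᵥ xR + L.R.D *ᵥ q) (hy : y = L.G.C *ᵥ xG + L.G.D *ᵥ u) :
    L.clA *ᵥ stack xK xR xG = stack (L.K.A *ᵥ xK + L.K.B *ᵥ e) (L.R.A *ᵥ xR + L.R.B *ᵥ q)
      (L.G.A *ᵥ xG + L.G.B *ᵥ u) := by
  have h1 := outE_stack hwp he hq hu hy
  have h2 : L.outQ (stack xK xR xG) = q := by
    rw [← clQ_mulVec_stack hwp he hq hu hy, clQ, LinearMap.toMatrix'_mulVec]
  have h3 : L.outU (stack xK xR xG) = u := by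
    change L.R.C *ᵥ xR + L.R.D *ᵥ L.outQ (stack xK xR xG) = u
    rw [h2, hu]
  rw [clA, LinearMap.toMatrix'_mulVec]
  change stack (L.K.A *ᵥ xK + L.K.B *ᵥ L.outE (stack xK xR xG))
    (L.R.A *ᵥ xR + L.R.B *ᵥ L.outQ (stack xK xR xG))
    (L.G.A *ᵥ xG + L.G.B *ᵥ L.outU (stack xK xR xG)) = _
  rw [h1, h2, h3]

theorem stack_re (xK : Fin nK → ℂ) (xR : Fin nR → ℂ) (xG : Fin nG → ℂ) :
    (fun i => (stack xK xR xG i).re) =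
      stack (fun i => (xK i).re) (fun i => (xR i).re) (fun i => (xG i).re) := by
  ext (i | i | i) <;> rfl

theorem stack_im (xK : Fin nK → ℂ) (xR : Fin nR → ℂ) (xG : Fin nG → ℂ) :
    (fun i => (stack xK xR xG i).im) =
      stack (fun i => (xK i).im) (fun i => (xR i).im) (fun i => (xG i).im) := by
  ext (i | i | i) <;> rfl

theorem re_affine {a b c : ℕ} {M : Matrix (Fin a) (Fin b) ℝ} {N : Matrix (Fin a) (Fin c) ℝ}
    {z : Fin b → ℂ} {v : Fin c → ℂ} {o : Fin a → ℂ} (h : o = toC M *ᵥ z + toC N *ᵥ v) :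
    (fun i => (o i).re) = (M *ᵥ fun i => (z i).re) + N *ᵥ fun i => (v i).re := by
  rw [h, ← re_cplx_mulVec, ← re_cplx_mulVec]
  rfl

theorem im_affine {a b c : ℕ} {M : Matrix (Fin a) (Fin b) ℝ} {N : Matrix (Fin a) (Fin c) ℝ}
    {z : Fin b → ℂ} {v : Fin c → ℂ} {o : Fin a → ℂ} (h : o = toC M *ᵥ z + toC N *ᵥ v) :
    (fun i => (o i).im) = (M *ᵥ fun i => (z i).im) + N *ᵥ fun i => (v i).im := by
  rw [h, ← im_cplx_mulVec, ← im_cplx_mulVec]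
  rfl

theorem cplx_clQ_mulVec_stack (hwp : L.WellPosed) {xK : Fin nK → ℂ} {xR : Fin nR → ℂ}
    {xG : Fin nG → ℂ} {e q u y : Fin 1 → ℂ} (he : e = -y)
    (hq : q = toC L.K.C *ᵥ xK + toC L.K.D *ᵥ e) (hu : u = toC L.R.C *ᵥ xR + toC L.R.D *ᵥ q)
    (hy : y = toC L.G.C *ᵥ xG + toC L.G.D *ᵥ u) :
    cplx L.clQ *ᵥ stack xK xR xG = q := by
  have hr := clQ_mulVec_stack (e := fun i => (e i).re) (y := fun i => (y i).re) hwp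
    (by rw [he]; ext i; simp) (re_affine hq) (re_affine hu) (re_affine hy)
  have hi := clQ_mulVec_stack (e := fun i => (e i).im) (y := fun i => (y i).im) hwp
    (by rw [he]; ext i; simp) (im_affine hq) (im_affine hu) (im_affine hy)
  rw [← stack_re, ← re_cplx_mulVec] at hr
  rw [← stack_im, ← im_cplx_mulVec] at hi
  ext i
  exact Complex.ext (congr_fun hr i) (congr_fun hi i)

/-- The matrices are real, so the real and the imaginary parts of the phasors each satisfy the real
loop equations. -/
theorem cplx_clA_mulVec_stack (hwp : L.WellPosed) {xK : Fin nK → ℂ} {xR : Fin nR → ℂ}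
    {xG : Fin nG → ℂ} {e q u y : Fin 1 → ℂ} (he : e = -y)
    (hq : q = toC L.K.C *ᵥ xK + toC L.K.D *ᵥ e) (hu : u = toC L.R.C *ᵥ xR + toC L.R.D *ᵥ q)
    (hy : y = toC L.G.C *ᵥ xG + toC L.G.D *ᵥ u) :
    cplx L.clA *ᵥ stack xK xR xG = stack (toC L.K.A *ᵥ xK + toC L.K.B *ᵥ e)
      (toC L.R.A *ᵥ xR + toC L.R.B *ᵥ q) (toC L.G.A *ᵥ xG + toC L.G.B *ᵥ u) := by
  have hr := clA_mulVec_stack (e := fun i => (e i).re) (y := fun i => (y i).re) hwp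
    (by rw [he]; ext i; simp) (re_affine hq) (re_affine hu) (re_affine hy)
  have hi := clA_mulVec_stack (e := fun i => (e i).im) (y := fun i => (y i).im) hwp
    (by rw [he]; ext i; simp) (im_affine hq) (im_affine hu) (im_affine hy)
  rw [← stack_re, ← re_cplx_mulVec, ← re_affine rfl, ← re_affine rfl, ← re_affine rfl,
    ← stack_re] at hr
  rw [← stack_im, ← im_cplx_mulVec, ← im_affine rfl, ← im_affine rfl, ← im_affine rfl,
    ← stack_im] at hi
  ext i
  exact Complex.ext (congr_fun hr i) (congr_fun hi i)

theorem selR_mulVec (X : Fin nK ⊕ Fin nR ⊕ Fin nG → ℝ) :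
    selR nK nR nG *ᵥ X = fun i => X (Sum.inr (Sum.inl i)) := by
  ext i
  simp [selR, Matrix.mulVec, dotProduct, Matrix.one_apply]

theorem cplx_selR_mulVec_stack (xK : Fin nK → ℂ) (xR : Fin nR → ℂ) (xG : Fin nG → ℂ) :
    cplx (selR nK nR nG) *ᵥ stack xK xR xG = xR := by
  ext i
  simp [selR, stack, Matrix.mulVec, dotProduct, Matrix.one_apply, cplx_apply,
    apply_ite (fun r : ℝ => (r : ℂ))]

theorem clJump_mulVec (x : Fin nR → ℝ) :
    L.clJump *ᵥ x = stack 0 ((L.Arho - 1) *ᵥ x) 0 := by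
  ext (i | i | i) <;> simp [clJump, stack, Matrix.mulVec, dotProduct]

theorem cplx_clJump_mulVec (x : Fin nR → ℂ) :
    cplx L.clJump *ᵥ x = stack 0 (toC (L.Arho - 1) *ᵥ x) 0 := by
  ext (i | i | i) <;> simp [clJump, stack, Matrix.mulVec, dotProduct, toC, cplx_apply]

end Loop

/-! ### The closed loop in the frequency domain -/

theorem smul_inv_mulVec {ι : Type*} [Fintype ι] [DecidableEq ι] {A : Matrix ι ι ℂ} {s : ℂ}
    (hs : IsUnit (s • (1 : Matrix ι ι ℂ) - A)) (b : ι → ℂ) :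
    s • ((s • (1 : Matrix ι ι ℂ) - A)⁻¹ *ᵥ b) =
      A *ᵥ ((s • (1 : Matrix ι ι ℂ) - A)⁻¹ *ᵥ b) + b := by
  rw [← Matrix.smul_mulVec, smul_inv_smul_one_sub hs, Matrix.add_mulVec, Matrix.one_mulVec,
    Matrix.mulVec_mulVec, add_comm]

theorem eq_inv_mulVec {ι : Type*} [Fintype ι] [DecidableEq ι] {A : Matrix ι ι ℂ} {s : ℂ}
    (hs : IsUnit (s • (1 : Matrix ι ι ℂ) - A)) {b x : ι → ℂ} (h : s • x = A *ᵥ x + b) :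
    x = (s • (1 : Matrix ι ι ℂ) - A)⁻¹ *ᵥ b := by
  have hb : b = (s • (1 : Matrix ι ι ℂ) - A) *ᵥ x := by
    rw [Matrix.sub_mulVec, Matrix.smul_mulVec, Matrix.one_mulVec, h, add_sub_cancel_left]
  rw [hb, Matrix.mulVec_mulVec,
    Matrix.nonsing_inv_mul _ ((Matrix.isUnit_iff_isUnit_det _).1 hs), Matrix.one_mulVec]

theorem StateSpace.tf_mulVec {n m p : ℕ} (S : StateSpace n m p) (s : ℂ) (v : Fin m → ℂ) :
    S.tf s *ᵥ v = toC S.C *ᵥ ((s • (1 : Matrix (Fin n) (Fin n) ℂ) - toC S.A)⁻¹ *ᵥ (toC S.B *ᵥ v)) +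
      toC S.D *ᵥ v := by
  rw [StateSpace.tf, Matrix.add_mulVec, Matrix.mulVec_mulVec, Matrix.mulVec_mulVec]

theorem StateSpace.tendsto_tf {n m p : ℕ} (S : StateSpace n m p) :
    Tendsto S.tf (cocompact ℂ) (𝓝 (toC S.D)) := by
  have h := (tendsto_transfer (toC S.C) (toC S.A) (toC S.B)).add_const (toC S.D)
  rwa [zero_add] at h

namespace Loop

variable {nK nR nG : ℕ} {L : Loop nK nR nG}

/-- At infinity the return difference tends to `1 + D_G D_R D_K`, which is invertible by
well-posedness. -/
theorem eventually_isUnit_returnDifference (hwp : L.WellPosed) :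
    ∀ᶠ s in cocompact ℂ, IsUnit (1 + L.G.tf s * L.R.tf s * L.K.tf s) := by
  have h : Tendsto (fun s => (1 + L.G.tf s * L.R.tf s * L.K.tf s).det) (cocompact ℂ)
      (𝓝 (1 + toC L.G.D * toC L.R.D * toC L.K.D).det) := by
    have hdet : Continuous (Matrix.det : Matrix (Fin 1) (Fin 1) ℂ → ℂ) := continuous_id.matrix_det
    exact (hdet.tendsto _).comp
      (((L.G.tendsto_tf.mul L.R.tendsto_tf).mul L.K.tendsto_tf).const_add 1)
  have hne : (1 + toC L.G.D * toC L.R.D * toC L.K.D).det ≠ 0 := by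
    have h0 := ((Matrix.isUnit_iff_isUnit_det _).1 hwp).ne_zero
    simp only [Matrix.det_unique, Matrix.add_apply, Matrix.mul_apply, Matrix.one_apply_eq] at h0 ⊢
    simpa [toC] using (Complex.ofReal_ne_zero.2 h0)
  filter_upwards [h.eventually_ne hne] with s hs
  exact (Matrix.isUnit_iff_isUnit_det _).2 (isUnit_iff_ne_zero.2 hs)

/-- The closed-loop response to a reset impulse in the frequency domain. -/
theorem resolvent_clA_mulVec_jump (hwp : L.WellPosed) {s : ℂ}
    (hK : IsUnit (s • (1 : Matrix (Fin nK) (Fin nK) ℂ) - toC L.K.A))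
    (hR : IsUnit (s • (1 : Matrix (Fin nR) (Fin nR) ℂ) - toC L.R.A))
    (hG : IsUnit (s • (1 : Matrix (Fin nG) (Fin nG) ℂ) - toC L.G.A))
    (hA : IsUnit (s • (1 : Matrix _ _ ℂ) - cplx L.clA))
    (hS : IsUnit (1 + L.G.tf s * L.R.tf s * L.K.tf s)) :
    cplx L.clQ * (s • (1 : Matrix _ _ ℂ) - cplx L.clA)⁻¹ * cplx L.clJump = -L.Qd s ∧
    cplx (selR nK nR nG) * (s • (1 : Matrix _ _ ℂ) - cplx L.clA)⁻¹ * cplx L.clJump = L.H s := by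
  suffices h : ∀ v : Fin nR → ℂ,
      cplx L.clQ *ᵥ ((s • (1 : Matrix _ _ ℂ) - cplx L.clA)⁻¹ *ᵥ (cplx L.clJump *ᵥ v)) =
        -L.Qd s *ᵥ v ∧
      cplx (selR nK nR nG) *ᵥ ((s • (1 : Matrix _ _ ℂ) - cplx L.clA)⁻¹ *ᵥ
        (cplx L.clJump *ᵥ v)) = L.H s *ᵥ v by
    constructor <;> refine Matrix.ext_of_mulVec_single fun i => ?_ <;>
      rw [← Matrix.mulVec_mulVec, ← Matrix.mulVec_mulVec]
    exacts [(h _).1, (h _).2]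
  intro v
  -- Transforms of `e`, `q`, `u`, `y` when the loop is driven only by the jump `v`; the value of `ε`
  -- is the one that `e = -y` forces.
  obtain ⟨ε, hε⟩ : ∃ ε, ε = -(L.SL s *ᵥ (L.G.tf s *ᵥ (L.Rd s *ᵥ v))) := ⟨_, rfl⟩
  obtain ⟨q, hq⟩ : ∃ q, q = L.K.tf s *ᵥ ε := ⟨_, rfl⟩
  obtain ⟨u, hu⟩ : ∃ u, u = L.R.tf s *ᵥ q + L.Rd s *ᵥ v := ⟨_, rfl⟩
  obtain ⟨y, hy⟩ : ∃ y, y = L.G.tf s *ᵥ u := ⟨_, rfl⟩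
  let xK := (s • (1 : Matrix (Fin nK) (Fin nK) ℂ) - toC L.K.A)⁻¹ *ᵥ (toC L.K.B *ᵥ ε)
  let xR := (s • (1 : Matrix (Fin nR) (Fin nR) ℂ) - toC L.R.A)⁻¹ *ᵥ
    (toC L.R.B *ᵥ q + toC (L.Arho - 1) *ᵥ v)
  let xG := (s • (1 : Matrix (Fin nG) (Fin nG) ℂ) - toC L.G.A)⁻¹ *ᵥ (toC L.G.B *ᵥ u)
  have he : ε = -y := by
    have h1 : (1 + L.G.tf s * L.R.tf s * L.K.tf s) *ᵥ ε = -(L.G.tf s *ᵥ (L.Rd s *ᵥ v)) := by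
      rw [hε, Matrix.mulVec_neg, Loop.SL, Matrix.mulVec_mulVec,
        Matrix.mul_nonsing_inv _ ((Matrix.isUnit_iff_isUnit_det _).1 hS), Matrix.one_mulVec]
    rw [Matrix.add_mulVec, Matrix.one_mulVec, ← Matrix.mulVec_mulVec, ← Matrix.mulVec_mulVec,
      ← hq] at h1
    rw [hy, hu, Matrix.mulVec_add, neg_add, ← h1]
    abel
  have hq' : q = toC L.K.C *ᵥ xK + toC L.K.D *ᵥ ε := by rw [hq, StateSpace.tf_mulVec]
  have hu' : u = toC L.R.C *ᵥ xR + toC L.R.D *ᵥ q := by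
    rw [hu, StateSpace.tf_mulVec, Loop.Rd, Loop.RdX]
    simp only [xR, Matrix.mulVec_add, ← Matrix.mulVec_mulVec]
    abel
  have hy' : y = toC L.G.C *ᵥ xG + toC L.G.D *ᵥ u := by rw [hy, StateSpace.tf_mulVec]
  -- The stacked state solves the resolvent equation of `clA` with right-hand side `clJump v`; by
  -- uniqueness it is the resolvent applied to that vector.
  have hX : s • stack xK xR xG = cplx L.clA *ᵥ stack xK xR xG + cplx L.clJump *ᵥ v := by
    rw [cplx_clA_mulVec_stack hwp he hq' hu' hy', cplx_clJump_mulVec]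
    have e1 := smul_inv_mulVec hK (toC L.K.B *ᵥ ε)
    have e2 := smul_inv_mulVec hR (toC L.R.B *ᵥ q + toC (L.Arho - 1) *ᵥ v)
    have e3 := smul_inv_mulVec hG (toC L.G.B *ᵥ u)
    rw [← add_assoc] at e2
    ext (i | i | i)
    · have := congr_fun e1 i
      simpa [stack, xK] using this
    · exact congr_fun e2 i
    · have := congr_fun e3 i
      simpa [stack, xG] using this
  rw [← eq_inv_mulVec hA hX, cplx_clQ_mulVec_stack hwp he hq' hu' hy', cplx_selR_mulVec_stack]
  have hqv : q = -(L.Qd s *ᵥ v) := by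
    rw [hq, hε, Matrix.mulVec_neg, Loop.Qd]
    simp only [← Matrix.mulVec_mulVec]
  refine ⟨by rw [hqv, Matrix.neg_mulVec], ?_⟩
  rw [Loop.H, Matrix.sub_mulVec]
  simp only [xR, Matrix.mulVec_add, Loop.RdX, Loop.RLX, ← Matrix.mulVec_mulVec]
  rw [hq, hε]
  simp only [Matrix.mulVec_neg]
  abel

theorem eventually_resolvent_clA (hwp : L.WellPosed) : ∀ᶠ s in cocompact ℂ,
    cplx L.clQ * (s • (1 : Matrix _ _ ℂ) - cplx L.clA)⁻¹ * cplx L.clJump = -L.Qd s ∧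
    cplx (selR nK nR nG) * (s • (1 : Matrix _ _ ℂ) - cplx L.clA)⁻¹ * cplx L.clJump = L.H s := by
  filter_upwards [eventually_isUnit_smul_one_sub (toC L.K.A),
    eventually_isUnit_smul_one_sub (toC L.R.A), eventually_isUnit_smul_one_sub (toC L.G.A),
    eventually_isUnit_smul_one_sub (cplx L.clA), eventually_isUnit_returnDifference hwp]
    with s h1 h2 h3 h4 h5
  exact resolvent_clA_mulVec_jump hwp h1 h2 h3 h4 h5

end Loop

/-- Two realizations of a strictly proper transfer matrix have the same impulse response. -/
theorem StateSpace.impulse_eq_of_eventually {n m p : ℕ} (S : StateSpace n m p) {ι : Type*}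
    [Fintype ι] [DecidableEq ι] {C : Matrix (Fin p) ι ℝ} {A : Matrix ι ι ℝ} {B : Matrix ι (Fin m) ℝ}
    (h : ∀ᶠ s in cocompact ℂ,
      S.tf s = cplx C * (s • (1 : Matrix ι ι ℂ) - cplx A)⁻¹ * cplx B) :
    S.D = 0 ∧ ∀ t : ℝ, S.impulse t = C * NormedSpace.exp (t • A) * B := by
  have hD : cplx S.D = 0 := by
    refine feedthrough_eq (C := toC S.C) (A := toC S.A) (B := toC S.B) (C' := cplx C)
      (A' := cplx A) (B' := cplx B) ?_
    filter_upwards [h] with s hs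
    rw [add_zero, ← hs]
    rfl
  refine ⟨cplx_injective (hD.trans cplx_zero.symm), exp_eq_of_markov_eq fun k => ?_⟩
  refine cplx_injective ?_
  simp only [cplx_mul, cplx_pow]
  refine markov_eq ?_ k
  filter_upwards [h] with s hs
  rw [← hs, StateSpace.tf]
  change _ = _ + cplx S.D
  rw [hD, add_zero]
  rfl

/-! ### Harmonic signals and their phasors -/

section Harmonic

variable {ι κ : Type*}

/-- The real signal with phasor `z` at angular frequency `ω`. -/
def phasorSignal (ω : ℝ) (z : ι → ℂ) (t : ℝ) : ι → ℝ :=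
  fun i => (Complex.exp ((ω * t : ℝ) * Complex.I) * z i).im

theorem phasorSignal_add (ω : ℝ) (z v : ι → ℂ) (t : ℝ) :
    phasorSignal ω (z + v) t = phasorSignal ω z t + phasorSignal ω v t := by
  ext i
  simp only [phasorSignal, Pi.add_apply, mul_add, Complex.add_im]

theorem phasorSignal_mulVec {a b : ℕ} (ω : ℝ) (M : Matrix (Fin a) (Fin b) ℝ) (z : Fin b → ℂ) (t : ℝ) :
    phasorSignal ω (toC M *ᵥ z) t = M *ᵥ phasorSignal ω z t := by
  have h := im_cplx_mulVec M (Complex.exp ((ω * t : ℝ) * Complex.I) • z)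
  rw [Matrix.mulVec_smul] at h
  exact h

theorem hasDerivAt_phasorSignal [Fintype ι] (ω : ℝ) (z : ι → ℂ) (t : ℝ) :
    HasDerivAt (phasorSignal ω z) (phasorSignal ω ((ω * Complex.I : ℂ) • z) t) t := by
  refine hasDerivAt_pi.2 fun i => ?_
  have h1 : HasDerivAt (fun s : ℝ => ((ω * s : ℝ) : ℂ) * Complex.I) (ω * Complex.I) t := by
    have h := ((hasDerivAt_id t).const_mul ω).ofReal_comp.mul_const Complex.I
    simpa using h
  have h2 := (h1.cexp.mul_const (z i))
  have h3 := Complex.imCLM.hasFDerivAt.comp_hasDerivAt t h2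
  refine h3.congr_deriv ?_
  simp only [phasorSignal, Complex.imCLM_apply, Pi.smul_apply, smul_eq_mul]
  ring_nf

theorem phasorSignal_periodic {ω : ℝ} (hω : 0 < ω) (z : ι → ℂ) :
    Function.Periodic (phasorSignal ω z) (2 * Real.pi / ω) := by
  intro t
  ext i
  have e : (((ω * (t + 2 * Real.pi / ω) : ℝ) : ℂ)) * Complex.I =
      ((ω * t : ℝ) : ℂ) * Complex.I + 2 * Real.pi * Complex.I := by
    have : ω * (t + 2 * Real.pi / ω) = ω * t + 2 * Real.pi := by field_simp
    rw [this]
    push_cast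
    ring
  simp only [phasorSignal, e, Complex.exp_periodic _]

theorem eq_zero_of_phasorSignal_eq_zero {ω : ℝ} (hω : 0 < ω) {z : ι → ℂ}
    (h : ∀ t, phasorSignal ω z t = 0) : z = 0 := by
  ext i
  have h0 := congr_fun (h 0) i
  have h1 := congr_fun (h (Real.pi / 2 / ω)) i
  have e : ((ω * (Real.pi / 2 / ω) : ℝ) : ℂ) = Real.pi / 2 := by
    rw [mul_div_cancel₀ _ hω.ne']
    push_cast
    rfl
  simp only [phasorSignal, mul_zero, Complex.ofReal_zero, zero_mul, Complex.exp_zero, one_mul,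
    Pi.zero_apply] at h0
  simp only [phasorSignal, e, Complex.exp_pi_div_two_mul_I, Pi.zero_apply, Complex.mul_im,
    Complex.I_re, Complex.I_im, zero_mul, one_mul, zero_add] at h1
  exact Complex.ext h1 h0

theorem phasorSignal_eq_norm_mul_sin (ω : ℝ) (z : ι → ℂ) (t : ℝ) (i : ι) :
    phasorSignal ω z t i = ‖z i‖ * Real.sin (ω * t + Complex.arg (z i)) := by
  have hz := Complex.norm_mul_exp_arg_mul_I (z i)
  have e : Complex.exp ((ω * t : ℝ) * Complex.I) * z i =
      (‖z i‖ : ℂ) * Complex.exp (((ω * t + Complex.arg (z i) : ℝ) : ℂ) * Complex.I) := by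
    conv_lhs => rw [← hz]
    rw [mul_left_comm, ← Complex.exp_add]
    push_cast
    ring_nf
  rw [phasorSignal, e, Complex.im_ofReal_mul, Complex.exp_ofReal_mul_I_im]

theorem periodic_eq_of_tendsto {E : Type*} [TopologicalSpace E] [T2Space E] {f : ℝ → E}
    {P : ℝ} (hf : Function.Periodic f P) (hP : 0 < P) {c : E} (h : Tendsto f atTop (𝓝 c)) (t : ℝ) :
    f t = c := by
  have h1 : Tendsto (fun n : ℕ => t + n * P) atTop atTop :=
    tendsto_atTop_add_const_left _ _ (tendsto_natCast_atTop_atTop.atTop_mul_const hP)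
  refine tendsto_nhds_unique (tendsto_const_nhds.congr fun n => ?_) (h.comp h1)
  exact (hf.nat_mul n t).symm

end Harmonic

/-- The difference of two sets of signals. -/
def Signals.sub {nK nR nG : ℕ} (w v : Signals nK nR nG) : Signals nK nR nG where
  xK := fun t => w.xK t - v.xK t
  xR := fun t => w.xR t - v.xR t
  xG := fun t => w.xG t - v.xG t
  e := fun t => w.e t - v.e t
  q := fun t => w.q t - v.q t
  u := fun t => w.u t - v.u t
  y := fun t => w.y t - v.y t

/-- The joint state trajectory. -/
def Signals.state {nK nR nG : ℕ} (w : Signals nK nR nG) (t : ℝ) :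
    Fin nK ⊕ Fin nR ⊕ Fin nG → ℝ :=
  stack (w.xK t) (w.xR t) (w.xG t)

theorem Signals.StatesPeriodic.sub {nK nR nG : ℕ} {w v : Signals nK nR nG} {P : ℝ}
    (hw : w.StatesPeriodic P) (hv : v.StatesPeriodic P) : (w.sub v).StatesPeriodic P :=
  ⟨fun t => congr_arg₂ (· - ·) (hw.1 t) (hv.1 t), fun t => congr_arg₂ (· - ·) (hw.2.1 t) (hv.2.1 t),
    fun t => congr_arg₂ (· - ·) (hw.2.2 t) (hv.2.2 t)⟩

/-! ### The base-linear steady state and the deviation from it -/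

namespace Loop

variable {nK nR nG : ℕ} {L : Loop nK nR nG}

theorem Interconnected.sub {r : ℝ → ℝ} {w v : Signals nK nR nG} (hw : L.Interconnected r w)
    (hv : L.Interconnected r v) : L.Interconnected (fun _ => 0) (w.sub v) := by
  intro t
  obtain ⟨h1, h2, h3, h4⟩ := hw t
  obtain ⟨k1, k2, k3, k4⟩ := hv t
  refine ⟨?_, ?_, ?_, ?_⟩ <;> dsimp only [Signals.sub]
  · rw [h1, k1]
    ext i
    simp
  · rw [h2, k2, Matrix.mulVec_sub, Matrix.mulVec_sub]
    abel
  · rw [h3, k3, Matrix.mulVec_sub, Matrix.mulVec_sub]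
    abel
  · rw [h4, k4, Matrix.mulVec_sub, Matrix.mulVec_sub]
    abel

theorem FlowsAt.sub {w v : Signals nK nR nG} {t : ℝ} (hw : L.FlowsAt w t) (hv : L.FlowsAt v t) :
    L.FlowsAt (w.sub v) t := by
  refine ⟨(hw.1.sub hv.1).congr_deriv ?_, (hw.2.1.sub hv.2.1).congr_deriv ?_,
    (hw.2.2.sub hv.2.2).congr_deriv ?_⟩ <;> dsimp only [Signals.sub] <;>
    rw [Matrix.mulVec_sub, Matrix.mulVec_sub] <;> abel

theorem IsBLSResponse.sub {r : ℝ → ℝ} {w v : Signals nK nR nG} (hw : L.IsBLSResponse r w)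
    (hv : L.IsBLSResponse r v) : L.IsBLSResponse (fun _ => 0) (w.sub v) :=
  ⟨hw.interconnected.sub hv.interconnected, fun t => (hw.flows t).sub (hv.flows t)⟩

theorem Interconnected.neg_y {w : Signals nK nR nG} (h : L.Interconnected (fun _ => 0) w) (t : ℝ) :
    w.e t = -w.y t := by
  rw [(h t).1]
  ext i
  simp

theorem Interconnected.outE_state (hwp : L.WellPosed) {w : Signals nK nR nG}
    (h : L.Interconnected (fun _ => 0) w) (t : ℝ) : L.outE (w.state t) = w.e t :=
  outE_stack hwp (h.neg_y t) (h t).2.1 (h t).2.2.1 (h t).2.2.2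

theorem Interconnected.clQ_state (hwp : L.WellPosed) {w : Signals nK nR nG}
    (h : L.Interconnected (fun _ => 0) w) (t : ℝ) : L.clQ *ᵥ w.state t = w.q t :=
  clQ_mulVec_stack hwp (h.neg_y t) (h t).2.1 (h t).2.2.1 (h t).2.2.2

theorem Interconnected.hasDerivAt_state (hwp : L.WellPosed) {w : Signals nK nR nG}
    (h : L.Interconnected (fun _ => 0) w) {t : ℝ} (hf : L.FlowsAt w t) :
    HasDerivAt w.state (L.clA *ᵥ w.state t) t := by
  rw [Signals.state, clA_mulVec_stack hwp (h.neg_y t) (h t).2.1 (h t).2.2.1 (h t).2.2.2]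
  refine hasDerivAt_pi.2 ?_
  rintro (i | i | i)
  · exact hasDerivAt_pi.1 hf.1 i
  · exact hasDerivAt_pi.1 hf.2.1 i
  · exact hasDerivAt_pi.1 hf.2.2 i

/-- An unforced periodic response of a stable loop vanishes. -/
theorem state_eq_zero_of_periodic (hstab : L.BLSStable) {w : Signals nK nR nG}
    (hw : L.IsBLSResponse (fun _ => 0) w) {P : ℝ} (hP : 0 < P) (hper : w.StatesPeriodic P) (t : ℝ) :
    w.state t = 0 := by
  obtain ⟨h1, h2, h3⟩ := hstab w hw
  rw [Signals.state, periodic_eq_of_tendsto hper.1 hP h1,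
    periodic_eq_of_tendsto hper.2.1 hP h2, periodic_eq_of_tendsto hper.2.2 hP h3]
  ext (i | i | i) <;> rfl

/-- Converse of `outE_stack`: the signals read off an arbitrary joint state satisfy the plant output
equation. This lets `exists_response` start from any state. -/
theorem neg_outE (hwp : L.WellPosed) (X : Fin nK ⊕ Fin nR ⊕ Fin nG → ℝ) :
    -L.outE X = L.G.C *ᵥ projG nK nR nG X + L.G.D *ᵥ L.outU X := by
  have hinv := Matrix.mul_nonsing_inv _ ((Matrix.isUnit_iff_isUnit_det _).1 hwp)
  obtain ⟨e, he⟩ : ∃ e, e = L.outE X := ⟨_, rfl⟩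
  have h : (1 + L.G.D * L.R.D * L.K.D) *ᵥ e = -(L.G.C *ᵥ projG nK nR nG X +
      L.G.D *ᵥ (L.R.C *ᵥ projR nK nR nG X + L.R.D *ᵥ (L.K.C *ᵥ projK nK nR nG X))) := by
    have h' : e = -((1 + L.G.D * L.R.D * L.K.D)⁻¹ *ᵥ (L.G.C *ᵥ projG nK nR nG X +
      L.G.D *ᵥ (L.R.C *ᵥ projR nK nR nG X + L.R.D *ᵥ (L.K.C *ᵥ projK nK nR nG X)))) := he
    rw [h', Matrix.mulVec_neg, Matrix.mulVec_mulVec, hinv, Matrix.one_mulVec]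
  rw [Matrix.add_mulVec, Matrix.one_mulVec, ← Matrix.mulVec_mulVec, ← Matrix.mulVec_mulVec] at h
  have hU : L.outU X = L.R.C *ᵥ projR nK nR nG X +
      L.R.D *ᵥ (L.K.C *ᵥ projK nK nR nG X + L.K.D *ᵥ L.outE X) := rfl
  rw [hU, ← he]
  nth_rewrite 1 [eq_sub_of_add_eq h]
  simp only [Matrix.mulVec_add]
  abel

/-- The unforced response with a given initial joint state. -/
theorem exists_response (hwp : L.WellPosed) (X : Fin nK ⊕ Fin nR ⊕ Fin nG → ℝ) :
    ∃ w : Signals nK nR nG, L.IsBLSResponse (fun _ => 0) w ∧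
      ∀ t, w.state t = NormedSpace.exp (t • L.clA) *ᵥ X := by
  let Z : ℝ → Fin nK ⊕ Fin nR ⊕ Fin nG → ℝ := fun t => NormedSpace.exp (t • L.clA) *ᵥ X
  let w : Signals nK nR nG :=
    { xK := fun t => projK nK nR nG (Z t)
      xR := fun t => projR nK nR nG (Z t)
      xG := fun t => projG nK nR nG (Z t)
      e := fun t => L.outE (Z t)
      q := fun t => L.outQ (Z t)
      u := fun t => L.outU (Z t)
      y := fun t => -L.outE (Z t) }
  have hZ : ∀ t, w.state t = Z t := fun t => by ext (i | i | i) <;> rfl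
  have hint : L.Interconnected (fun _ => 0) w := by
    intro t
    refine ⟨?_, rfl, rfl, ?_⟩
    · ext i
      simp [w]
    · exact neg_outE hwp (Z t)
  refine ⟨w, ⟨hint, fun t => ?_⟩, hZ⟩
  have hd := hasDerivAt_exp_smul_mulVec L.clA X t
  have hA := clA_mulVec_stack hwp (hint.neg_y t) (hint t).2.1 (hint t).2.2.1 (hint t).2.2.2
  change L.clA *ᵥ w.state t = _ at hA
  rw [hZ] at hA
  change HasDerivAt Z (L.clA *ᵥ Z t) t at hd
  rw [hA] at hd
  have hd' := hasDerivAt_pi.1 hd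
  exact ⟨hasDerivAt_pi.2 fun i => hd' (Sum.inl i),
    hasDerivAt_pi.2 fun i => hd' (Sum.inr (Sum.inl i)),
    hasDerivAt_pi.2 fun i => hd' (Sum.inr (Sum.inr i))⟩

/-- Every initial joint state belongs to some unforced response, so stability stated for responses
becomes decay of the flow of `clA`. -/
theorem tendsto_exp_clA_mulVec (hwp : L.WellPosed) (hstab : L.BLSStable)
    (X : Fin nK ⊕ Fin nR ⊕ Fin nG → ℝ) :
    Tendsto (fun t : ℝ => NormedSpace.exp (t • L.clA) *ᵥ X) atTop (𝓝 0) := by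
  obtain ⟨w, hw, hX⟩ := exists_response hwp X
  obtain ⟨h1, h2, h3⟩ := hstab w hw
  simp only [← hX]
  refine tendsto_pi_nhds.2 ?_
  rintro (i | i | i)
  · exact tendsto_pi_nhds.1 h1 i
  · exact tendsto_pi_nhds.1 h2 i
  · exact tendsto_pi_nhds.1 h3 i

variable (L) in
/-- The signals of the base-linear system whose signal `e` is harmonic with phasor `ε`. -/
def harmonicSignals (ω : ℝ) (ε : Fin 1 → ℂ) : Signals nK nR nG :=
  let s : ℂ := ω * Complex.I
  let q := L.K.tf s *ᵥ ε
  let u := L.R.tf s *ᵥ q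
  { xK := phasorSignal ω ((s • (1 : Matrix (Fin nK) (Fin nK) ℂ) - toC L.K.A)⁻¹ *ᵥ (toC L.K.B *ᵥ ε))
    xR := phasorSignal ω ((s • (1 : Matrix (Fin nR) (Fin nR) ℂ) - toC L.R.A)⁻¹ *ᵥ (toC L.R.B *ᵥ q))
    xG := phasorSignal ω ((s • (1 : Matrix (Fin nG) (Fin nG) ℂ) - toC L.G.A)⁻¹ *ᵥ (toC L.G.B *ᵥ u))
    e := phasorSignal ω ε
    q := phasorSignal ω q
    u := phasorSignal ω u
    y := phasorSignal ω (L.G.tf s *ᵥ u) }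

theorem harmonicSignals_periodic {ω : ℝ} (hω : 0 < ω) (ε : Fin 1 → ℂ) :
    (L.harmonicSignals ω ε).StatesPeriodic (2 * Real.pi / ω) :=
  ⟨phasorSignal_periodic hω _, phasorSignal_periodic hω _, phasorSignal_periodic hω _⟩

theorem isBLSResponse_harmonicSignals {ω : ℝ}
    (hK : IsUnit ((ω * Complex.I : ℂ) • (1 : Matrix (Fin nK) (Fin nK) ℂ) - toC L.K.A))
    (hR : IsUnit ((ω * Complex.I : ℂ) • (1 : Matrix (Fin nR) (Fin nR) ℂ) - toC L.R.A))
    (hG : IsUnit ((ω * Complex.I : ℂ) • (1 : Matrix (Fin nG) (Fin nG) ℂ) - toC L.G.A))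
    {r : ℝ → ℝ} {ε ρ : Fin 1 → ℂ} (hr : ∀ t, phasorSignal ω ρ t = fun _ => r t)
    (hε : (1 + L.G.tf (ω * Complex.I) * L.R.tf (ω * Complex.I) * L.K.tf (ω * Complex.I)) *ᵥ ε = ρ) :
    L.IsBLSResponse r (L.harmonicSignals ω ε) := by
  constructor
  · intro t
    refine ⟨?_, ?_, ?_, ?_⟩ <;> dsimp only [harmonicSignals]
    · rw [← hr, ← hε, Matrix.add_mulVec, Matrix.one_mulVec, ← Matrix.mulVec_mulVec,
        ← Matrix.mulVec_mulVec, phasorSignal_add, add_sub_cancel_right]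
    all_goals rw [StateSpace.tf_mulVec _ _ _, phasorSignal_add, phasorSignal_mulVec, phasorSignal_mulVec]
  · intro t
    refine ⟨?_, ?_, ?_⟩
    · refine (hasDerivAt_phasorSignal ω _ t).congr_deriv ?_
      rw [smul_inv_mulVec hK, phasorSignal_add, phasorSignal_mulVec, phasorSignal_mulVec]
      rfl
    · refine (hasDerivAt_phasorSignal ω _ t).congr_deriv ?_
      rw [smul_inv_mulVec hR, phasorSignal_add, phasorSignal_mulVec, phasorSignal_mulVec]
      rfl
    · refine (hasDerivAt_phasorSignal ω _ t).congr_deriv ?_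
      rw [smul_inv_mulVec hG, phasorSignal_add, phasorSignal_mulVec, phasorSignal_mulVec]
      rfl

/-- A kernel vector would be the phasor of `e` in an unforced periodic response. Such a response
vanishes by stability, and so does the phasor. -/
theorem isUnit_returnDifference (hwp : L.WellPosed) (hstab : L.BLSStable) {ω : ℝ} (hω : 0 < ω)
    (hK : IsUnit ((ω * Complex.I : ℂ) • (1 : Matrix (Fin nK) (Fin nK) ℂ) - toC L.K.A))
    (hR : IsUnit ((ω * Complex.I : ℂ) • (1 : Matrix (Fin nR) (Fin nR) ℂ) - toC L.R.A))
    (hG : IsUnit ((ω * Complex.I : ℂ) • (1 : Matrix (Fin nG) (Fin nG) ℂ) - toC L.G.A)) :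
    IsUnit (1 + L.G.tf (ω * Complex.I) * L.R.tf (ω * Complex.I) * L.K.tf (ω * Complex.I)) := by
  rw [Matrix.isUnit_iff_isUnit_det, isUnit_iff_ne_zero]
  intro hdet
  obtain ⟨ε, hε0, hε⟩ := Matrix.exists_mulVec_eq_zero_iff.2 hdet
  have hw := isBLSResponse_harmonicSignals (r := fun _ => 0) hK hR hG
    (fun t => by ext i; simp [phasorSignal]) hε
  refine hε0 (eq_zero_of_phasorSignal_eq_zero hω fun t => ?_)
  have h := hw.interconnected.outE_state hwp t
  rw [state_eq_zero_of_periodic hstab hw (div_pos Real.two_pi_pos hω)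
    (harmonicSignals_periodic hω ε), map_zero] at h
  exact h.symm

/-- The periodic response of the base-linear system to a sinusoid. -/
theorem periodicResponse_eq (hwp : L.WellPosed) (hstab : L.BLSStable) {ω : ℝ} (hω : 0 < ω) {RI : ℂ}
    (hK : IsUnit ((ω * Complex.I : ℂ) • (1 : Matrix (Fin nK) (Fin nK) ℂ) - toC L.K.A))
    (hR : IsUnit ((ω * Complex.I : ℂ) • (1 : Matrix (Fin nR) (Fin nR) ℂ) - toC L.R.A))
    (hG : IsUnit ((ω * Complex.I : ℂ) • (1 : Matrix (Fin nG) (Fin nG) ℂ) - toC L.G.A))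
    {v : Signals nK nR nG} (hv : L.IsBLSResponse (sinusoid ω RI) v)
    (hper : v.StatesPeriodic (2 * Real.pi / ω)) :
    ∃ z : Fin 1 → ℂ, ‖z 0‖ = L.blsMag ω RI ∧ (∀ t, v.q t = phasorSignal ω z t) ∧
      ∀ t, v.xR t = phasorSignal ω (L.RLX (ω * Complex.I) *ᵥ z) t := by
  let ε : Fin 1 → ℂ := L.SL (ω * Complex.I) *ᵥ fun _ => RI
  have hε : (1 + L.G.tf (ω * Complex.I) * L.R.tf (ω * Complex.I) * L.K.tf (ω * Complex.I)) *ᵥ ε =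
      fun _ => RI := by
    rw [Matrix.mulVec_mulVec, Loop.SL, Matrix.mul_nonsing_inv _ ((Matrix.isUnit_iff_isUnit_det _).1
      (isUnit_returnDifference hwp hstab hω hK hR hG)), Matrix.one_mulVec]
  have hh := isBLSResponse_harmonicSignals (r := sinusoid ω RI) hK hR hG
    (fun t => by ext i; rw [phasorSignal_eq_norm_mul_sin]; rfl) hε
  -- The difference from the harmonic response is unforced and periodic, hence zero.
  have hd := hv.sub hh
  have h0 := state_eq_zero_of_periodic hstab hd (div_pos Real.two_pi_pos hω)
    (hper.sub (harmonicSignals_periodic hω ε))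
  refine ⟨L.K.tf (ω * Complex.I) *ᵥ ε, ?_, fun t => ?_, fun t => ?_⟩
  · rw [Matrix.mulVec_mulVec, Loop.blsMag]
    simp [Matrix.mulVec, dotProduct]
  · have h := hd.interconnected.clQ_state hwp t
    rw [h0, Matrix.mulVec_zero] at h
    exact sub_eq_zero.1 h.symm
  · have h : v.xR t - (L.harmonicSignals ω ε).xR t = 0 := by
      ext i
      exact congr_fun (h0 t) (Sum.inr (Sum.inl i))
    rw [sub_eq_zero.1 h, Loop.RLX, ← Matrix.mulVec_mulVec]
    rfl

/-- Over half a period, the deviation from the base-linear response jumps and then flows freely. -/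
theorem deviation_across (hwp : L.WellPosed) {ω : ℝ} (hω : 0 < ω) {r : ℝ → ℝ} {tρ : ℝ}
    {w v : Signals nK nR nG} (hw : L.IsResetResponse r (resetInstants ω tρ) w)
    (hv : L.IsBLSResponse r v) {t : ℝ} (ht : t ∈ resetInstants ω tρ) :
    (w.sub v).state (t + Real.pi / ω) = NormedSpace.exp ((Real.pi / ω) • L.clA) *ᵥ
      ((w.sub v).state t + L.clJump *ᵥ w.xR t) := by
  have hh : 0 < Real.pi / ω := div_pos Real.pi_pos hω
  obtain ⟨p, hp⟩ := ht
  have ht : t ∈ resetInstants ω tρ := ⟨p, hp⟩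
  have ht' : t + Real.pi / ω ∈ resetInstants ω tρ := ⟨p + 1, by rw [hp]; push_cast; ring⟩
  -- Consecutive reset instants are `π/ω` apart, so the deviation flows freely strictly between
  -- them.
  have hout : ∀ s ∈ Set.Ioo t (t + Real.pi / ω), s ∉ resetInstants ω tρ := by
    rintro s ⟨hs1, hs2⟩ ⟨p', hp'⟩
    have h1 : (p : ℝ) * (Real.pi / ω) < p' * (Real.pi / ω) := by linarith
    have h2 : (p' : ℝ) * (Real.pi / ω) < (p + 1) * (Real.pi / ω) := by linarith
    have h3 : p < p' := by exact_mod_cast lt_of_mul_lt_mul_right h1 hh.le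
    have h4 : p' < p + 1 := by exact_mod_cast lt_of_mul_lt_mul_right h2 hh.le
    omega
  have hint := hw.interconnected.sub hv.interconnected
  have hlim : ∀ {l : Filter ℝ} {a : Fin nK → ℝ} {b : Fin nR → ℝ} {c : Fin nG → ℝ},
      Tendsto (w.sub v).xK l (𝓝 a) → Tendsto (w.sub v).xR l (𝓝 b) →
      Tendsto (w.sub v).xG l (𝓝 c) → Tendsto (w.sub v).state l (𝓝 (stack a b c)) := by
    intro l a b c ha hb hc
    refine tendsto_pi_nhds.2 ?_
    rintro (i | i | i)
    · exact tendsto_pi_nhds.1 ha i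
    · exact tendsto_pi_nhds.1 hb i
    · exact tendsto_pi_nhds.1 hc i
  have hcK : ∀ s ∈ resetInstants ω tρ, ContinuousAt (w.sub v).xK s := fun s hs =>
    (hw.continuousAt_xK s hs).sub (hv.flows s).1.continuousAt
  have hcG : ∀ s ∈ resetInstants ω tρ, ContinuousAt (w.sub v).xG s := fun s hs =>
    (hw.continuousAt_xG s hs).sub (hv.flows s).2.2.continuousAt
  have hright := hlim (l := 𝓝[>] t) ((hcK t ht).mono_left nhdsWithin_le_nhds)
    ((hw.jump_xR t ht).sub ((hv.flows t).2.1.continuousAt.mono_left nhdsWithin_le_nhds))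
    ((hcG t ht).mono_left nhdsWithin_le_nhds)
  have hleft := hlim (l := 𝓝[<] (t + Real.pi / ω)) ((hcK _ ht').mono_left nhdsWithin_le_nhds)
    (((hw.left_xR _ ht').mono_left (nhdsWithin_mono _ Set.Iio_subset_Iic_self)).sub
      ((hv.flows _).2.1.continuousAt.mono_left nhdsWithin_le_nhds))
    ((hcG _ ht').mono_left nhdsWithin_le_nhds)
  have h := flow_across (lt_add_of_pos_right t hh)
    (fun s hs => hint.hasDerivAt_state hwp ((hw.flows s (hout s hs)).sub (hv.flows s)))
    hright hleft
  rw [add_sub_cancel_left] at h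
  refine h.trans (congr_arg _ ?_)
  rw [clJump_mulVec, Matrix.sub_mulVec, Matrix.one_mulVec]
  ext (i | i | i)
  · simp [stack, Signals.state]
  · simp only [stack, Signals.state, Signals.sub, Sum.elim_inr, Sum.elim_inl, Pi.add_apply,
      Pi.sub_apply]
    ring
  · simp [stack, Signals.state]

/-- The deviation from the base-linear response at a reset instant is the sum of the responses to
the earlier resets. -/
theorem tendsto_sum_deviation (hwp : L.WellPosed) (hstab : L.BLSStable) {ω : ℝ} (hω : 0 < ω)
    {r : ℝ → ℝ} {tρ : ℝ} {w v : Signals nK nR nG}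
    (hw : L.IsResetResponse r (resetInstants ω tρ) w) (hv : L.IsBLSResponse r v)
    (hwper : w.StatesPeriodic (2 * Real.pi / ω)) (hvper : v.StatesPeriodic (2 * Real.pi / ω))
    (halt : w.xR (tρ + Real.pi / ω) = -w.xR tρ) :
    Tendsto (fun N : ℕ => ∑ k ∈ Finset.range N,
      (NormedSpace.exp ((Real.pi / ω) • L.clA) ^ (2 * k + 2) -
        NormedSpace.exp ((Real.pi / ω) • L.clA) ^ (2 * k + 1)) *ᵥ (L.clJump *ᵥ w.xR tρ)) atTop
      (𝓝 ((w.sub v).state tρ)) := by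
  have h0 := deviation_across hwp hω hw hv (t := tρ) ⟨0, by simp⟩
  have h1 := deviation_across hwp hω hw hv (t := tρ + Real.pi / ω) ⟨1, by simp⟩
  have hper := hwper.sub hvper
  have h2 : (w.sub v).state (tρ + Real.pi / ω + Real.pi / ω) = (w.sub v).state tρ := by
    have e : tρ + Real.pi / ω + Real.pi / ω = tρ + 2 * Real.pi / ω := by ring
    rw [e, Signals.state, hper.1, hper.2.1, hper.2.2, Signals.state]
  rw [h2, h0, halt] at h1
  -- `E^(2N)` is the closed-loop flow sampled at time `2N · π/ω`.
  have hlim : Tendsto (fun N : ℕ => NormedSpace.exp ((Real.pi / ω) • L.clA) ^ (2 * N) *ᵥ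
      (w.sub v).state tρ) atTop (𝓝 0) := by
    have ht : Tendsto (fun N : ℕ => ((2 * N : ℕ) : ℝ) * (Real.pi / ω)) atTop atTop :=
      (tendsto_natCast_atTop_atTop.comp
        (tendsto_id.const_mul_atTop' (two_pos (α := ℕ)))).atTop_mul_const
        (div_pos Real.pi_pos hω)
    refine ((tendsto_exp_clA_mulVec hwp hstab ((w.sub v).state tρ)).comp ht).congr fun N => ?_
    rw [← Matrix.exp_nsmul, ← Nat.cast_smul_eq_nsmul ℝ, smul_smul]
    rfl
  generalize NormedSpace.exp ((Real.pi / ω) • L.clA) = E at h1 hlim ⊢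
  generalize (w.sub v).state tρ = δ at h1 hlim ⊢
  generalize w.xR tρ = x at h1 ⊢
  have hsum : ∀ N : ℕ, ∑ k ∈ Finset.range N,
      (E ^ (2 * k + 2) - E ^ (2 * k + 1)) *ᵥ (L.clJump *ᵥ x) = δ - E ^ (2 * N) *ᵥ δ := by
    intro N
    induction N with
    | zero => simp
    | succ N ih =>
      rw [Finset.sum_range_succ, ih]
      -- `E^(2N)` applied to the one-period identity `δ = E(E(δ + J x) - J x)`; this splits off the
      -- `N`-th summand and leaves `E^(2N+2) δ`.
      have e : E ^ (2 * N) *ᵥ δ = E ^ (2 * N) *ᵥ (E *ᵥ (E *ᵥ (δ + L.clJump *ᵥ x) +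
          L.clJump *ᵥ -x)) := congr_arg _ h1
      simp only [Matrix.mulVec_add, Matrix.mulVec_neg, Matrix.mulVec_mulVec, ← Matrix.mul_assoc,
        ← pow_succ] at e
      rw [Matrix.sub_mulVec, Matrix.mulVec_mulVec, Matrix.mulVec_mulVec]
      rw [show 2 * (N + 1) = 2 * N + 2 by ring, e]
      abel
  simp only [hsum]
  simpa using hlim.const_sub δ

end Loop

/-- A series of impulse responses of a realization, evaluated by partial sums in another one. -/
theorem StateSpace.series_mulVec_eq {n m p : ℕ} (S : StateSpace n m p) (hS : AsympStable S.A)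
    {ω : ℝ} (hω : 0 < ω) {ι : Type*} [Fintype ι] [DecidableEq ι] {C : Matrix (Fin p) ι ℝ}
    {A : Matrix ι ι ℝ} {B : Matrix ι (Fin m) ℝ}
    (h : ∀ t : ℝ, S.impulse t = C * NormedSpace.exp (t • A) * B) {x : Fin m → ℝ} {δ : ι → ℝ}
    (hδ : Tendsto (fun N : ℕ => ∑ k ∈ Finset.range N,
      (NormedSpace.exp ((Real.pi / ω) • A) ^ (2 * k + 2) -
        NormedSpace.exp ((Real.pi / ω) • A) ^ (2 * k + 1)) *ᵥ (B *ᵥ x)) atTop (𝓝 δ)) :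
    S.series ω *ᵥ x = C *ᵥ δ := by
  let f : Matrix (Fin n) (Fin n) ℝ →+ (Fin p → ℝ) :=
    { toFun := fun M => (S.C * M * S.B) *ᵥ x
      map_zero' := by simp
      map_add' := fun M N => by rw [Matrix.mul_add, Matrix.add_mul, Matrix.add_mulVec] }
  have hf : Continuous fun M : Matrix (Fin n) (Fin n) ℝ => (S.C * M * S.B) *ᵥ x :=
    ((continuous_const.matrix_mul continuous_id).matrix_mul
      continuous_const).matrix_mulVec continuous_const
  have h1 := ((summable_seriesTerm hS hω).hasSum.map f hf).tendsto_sum_nat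
  have hC : Continuous fun z : ι → ℝ => C *ᵥ z := continuous_const.matrix_mulVec continuous_id
  refine tendsto_nhds_unique h1 (((hC.tendsto δ).comp hδ).congr fun N => ?_)
  -- Powers of the half-period exponential are samples of the impulse response at multiples of
  -- `π/ω`, where the two realizations agree.
  have hpow : ∀ k : ℕ, S.C * NormedSpace.exp ((Real.pi / ω) • S.A) ^ k * S.B =
      C * NormedSpace.exp ((Real.pi / ω) • A) ^ k * B := by
    intro k
    have := h (k * (Real.pi / ω))
    rwa [StateSpace.impulse, ← smul_smul, ← smul_smul, Nat.cast_smul_eq_nsmul,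
      Nat.cast_smul_eq_nsmul, Matrix.exp_nsmul, Matrix.exp_nsmul] at this
  change C *ᵥ _ = _
  rw [Matrix.mulVec_sum]
  refine Finset.sum_congr rfl fun k _ => ?_
  change _ = (S.C * seriesTerm ω S.A k * S.B) *ᵥ x
  rw [seriesTerm_eq, Matrix.mul_sub, Matrix.sub_mul, hpow, hpow, Matrix.mulVec_mulVec,
    Matrix.mulVec_mulVec, Matrix.mul_sub, Matrix.sub_mul]

/-! ### The phase rotation and its linearisation -/

theorem phaseRotation_eq (φ : ℝ) :
    phaseRotation φ = (Real.sin φ : ℂ) + (Real.cos φ : ℂ) * Complex.I := by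
  rw [phaseRotation, mul_comm, Complex.exp_mul_I, ← Complex.ofReal_cos, ← Complex.ofReal_sin,
    Real.cos_pi_div_two_sub, Real.sin_pi_div_two_sub]

/-- With `linearised_arcsin`, the linearised phase factor is `σ + j`, whereas the exact one is `σ +
j cos Φ` when `|σ| ≤ 1`. -/
theorem linearised_phaseRotation (φ : ℝ) : linearised phaseRotation φ = (φ : ℂ) + Complex.I := by
  have hd : HasDerivAt phaseRotation 1 0 := by
    have h1 := (Real.hasDerivAt_sin 0).ofReal_comp
    have h2 := (Real.hasDerivAt_cos 0).ofReal_comp.mul_const Complex.I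
    have h := h1.add h2
    simp only [Real.cos_zero, Real.sin_zero, neg_zero, Complex.ofReal_zero, zero_mul, add_zero,
      Complex.ofReal_one] at h
    exact h.congr_of_eventuallyEq (Eventually.of_forall phaseRotation_eq)
  rw [linearised, hd.deriv, phaseRotation_eq]
  simp [add_comm]

theorem linearised_arcsin (y : ℝ) : linearised Real.arcsin y = y := by
  have hd := Real.hasDerivAt_arcsin (x := 0) (by norm_num) (by norm_num)
  rw [linearised, hd.deriv]
  simp

/-! ### Solving the state equation -/

section StateEquation

variable {n : ℕ} {A : Matrix (Fin n) (Fin n) ℝ} {ω : ℝ}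

/-- From `-(A + jωI)(jωI - A) = ω²I + A²`. This gives the resolvent at `jω` explicitly through a
real inverse. -/
theorem inv_sq_add_sq_mul (hR : IsUnit (ω ^ 2 • (1 : Matrix (Fin n) (Fin n) ℝ) + A ^ 2)) :
    cplx (ω ^ 2 • (1 : Matrix (Fin n) (Fin n) ℝ) + A ^ 2)⁻¹ *
      -(toC A + (ω * Complex.I : ℂ) • 1) * ((ω * Complex.I : ℂ) • 1 - toC A) = 1 := by
  have h1 : -(toC A + (ω * Complex.I : ℂ) • (1 : Matrix (Fin n) (Fin n) ℂ)) *
      ((ω * Complex.I : ℂ) • 1 - toC A) =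
      cplx (ω ^ 2 • (1 : Matrix (Fin n) (Fin n) ℝ) + A ^ 2) := by
    have hs : (ω * Complex.I : ℂ) * (ω * Complex.I : ℂ) = -((ω ^ 2 : ℝ) : ℂ) := by
      rw [mul_mul_mul_comm, Complex.I_mul_I]
      push_cast
      ring
    rw [cplx_add, cplx_smul, cplx_one, cplx_pow, toC_eq_cplx]
    simp only [neg_add, neg_mul, smul_add, smul_neg, add_mul, mul_sub, smul_mul_assoc, mul_smul_comm, one_mul, mul_one,
      smul_smul, hs, neg_smul, pow_two (cplx A)]
    abel
  rw [Matrix.mul_assoc, h1, ← cplx_mul,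
    Matrix.nonsing_inv_mul _ ((Matrix.isUnit_iff_isUnit_det _).1 hR), cplx_one]

theorem isUnit_smul_one_sub_of_sq (hR : IsUnit (ω ^ 2 • (1 : Matrix (Fin n) (Fin n) ℝ) + A ^ 2)) :
    IsUnit ((ω * Complex.I : ℂ) • (1 : Matrix (Fin n) (Fin n) ℂ) - toC A) :=
  (Matrix.isUnit_iff_isUnit_det _).2
    (Matrix.isUnit_det_of_left_inverse (inv_sq_add_sq_mul hR))

variable {nK nR nG nQ nH : ℕ} {L : Loop nK nR nG} {Q : StateSpace nQ nR 1}
  {H : StateSpace nH nR nR}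

/-- The real part produces the `A_R B_R` term of the bracket, the imaginary part the vector `ω B_R`
of the formula. -/
theorem RLX_apply (hR : IsUnit (ω ^ 2 • (1 : Matrix (Fin nR) (Fin nR) ℝ) + L.R.A ^ 2))
    (i : Fin nR) :
    L.RLX (ω * Complex.I) i 0 =
      -((((ω ^ 2 • (1 : Matrix (Fin nR) (Fin nR) ℝ) + L.R.A ^ 2)⁻¹ * L.R.A * L.R.B) i 0 : ℝ) : ℂ) -
      ((((ω ^ 2 • (1 : Matrix (Fin nR) (Fin nR) ℝ) + L.R.A ^ 2)⁻¹ * (ω • L.R.B)) i 0 : ℝ) : ℂ) *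
        Complex.I := by
  have h : L.RLX (ω * Complex.I) =
      -cplx ((ω ^ 2 • (1 : Matrix (Fin nR) (Fin nR) ℝ) + L.R.A ^ 2)⁻¹ * L.R.A * L.R.B) -
      Complex.I •
        cplx ((ω ^ 2 • (1 : Matrix (Fin nR) (Fin nR) ℝ) + L.R.A ^ 2)⁻¹ * (ω • L.R.B)) := by
    rw [Loop.RLX, Matrix.inv_eq_left_inv (inv_sq_add_sq_mul hR), toC_eq_cplx, toC_eq_cplx]
    simp only [cplx_mul, cplx_smul, Matrix.mul_neg, Matrix.mul_add, Matrix.mul_smul, Matrix.mul_one,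
      Matrix.neg_mul, Matrix.add_mul, Matrix.smul_mul, smul_smul, mul_comm Complex.I]
    abel
  rw [h]
  simp only [Matrix.sub_apply, Matrix.neg_apply, Matrix.smul_apply, cplx_apply, smul_eq_mul]
  rw [mul_comm Complex.I]

theorem bracket_mulVec_apply (x : Fin nR → ℝ) (i : Fin nR) :
    (bracket L Q H ω *ᵥ x) i = x i +
      ((ω ^ 2 • (1 : Matrix (Fin nR) (Fin nR) ℝ) + L.R.A ^ 2)⁻¹ * L.R.A * L.R.B) i 0 *
        (Q.series ω *ᵥ x) 0 - (H.series ω *ᵥ x) i := by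
  rw [bracket, Matrix.sub_mulVec, Matrix.add_mulVec, Matrix.one_mulVec, ← Matrix.mulVec_mulVec]
  generalize Q.series ω *ᵥ x = y
  simp only [Pi.sub_apply, Pi.add_apply]
  congr 2
  simp [Matrix.mulVec, dotProduct]

theorem stateFormula_eq (M : ℝ) :
    stateFormula L Q H ω M = (bracket L Q H ω)⁻¹ *ᵥ fun i =>
      ((ω ^ 2 • (1 : Matrix (Fin nR) (Fin nR) ℝ) + L.R.A ^ 2)⁻¹ * (ω • L.R.B)) i 0 * M := by
  rw [stateFormula, Matrix.mul_assoc, ← Matrix.mulVec_mulVec]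
  congr 1
  ext i
  simp [Matrix.mulVec, dotProduct]

/-- The state equation with the phase factor `σ + j d` in place of the rotation, solved for the
reset state. -/
theorem eq_stateRHS_iff (hR : IsUnit (ω ^ 2 • (1 : Matrix (Fin nR) (Fin nR) ℝ) + L.R.A ^ 2))
    {M : ℝ} (hM : M ≠ 0) {asin : ℝ → ℝ} {rot : ℝ → ℂ} {x : Fin nR → ℝ} {d : ℝ}
    (hrot : rot (asin (phaseArg Q ω M x)) = (phaseArg Q ω M x : ℂ) + (d : ℂ) * Complex.I) :
    x = stateRHS L Q H ω M asin rot x ↔ bracket L Q H ω *ᵥ x = d • fun i =>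
      ((ω ^ 2 • (1 : Matrix (Fin nR) (Fin nR) ℝ) + L.R.A ^ 2)⁻¹ * (ω • L.R.B)) i 0 * M := by
  have hσ : M * phaseArg Q ω M x = (Q.series ω *ᵥ x) 0 := mul_div_cancel₀ _ hM
  rw [funext_iff, funext_iff]
  refine forall_congr' fun i => ?_
  change x i = (L.RLX (ω * Complex.I) i 0 * (M : ℂ) * rot (asin (phaseArg Q ω M x))).re +
    (H.series ω *ᵥ x) i ↔ _
  rw [bracket_mulVec_apply, ← hσ, hrot, RLX_apply hR]
  simp only [Pi.smul_apply, smul_eq_mul]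
  generalize ((ω ^ 2 • (1 : Matrix (Fin nR) (Fin nR) ℝ) + L.R.A ^ 2)⁻¹ * L.R.A * L.R.B) i 0 = a
  generalize ((ω ^ 2 • (1 : Matrix (Fin nR) (Fin nR) ℝ) + L.R.A ^ 2)⁻¹ * (ω • L.R.B)) i 0 = b
  have hre : ((-(a : ℂ) - (b : ℂ) * Complex.I) * (M : ℂ) *
      ((phaseArg Q ω M x : ℂ) + (d : ℂ) * Complex.I)).re =
      -(a * (M * phaseArg Q ω M x)) + d * (b * M) := by
    simp
    ring
  rw [hre]
  constructor <;> intro h <;> linarith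

/-- Used with `d = cos Φ` for the exact equation and `d = 1` for the linearised one. -/
theorem eq_smul_stateFormula_iff (hbr : IsUnit (bracket L Q H ω)) {M d : ℝ} {x : Fin nR → ℝ} :
    (bracket L Q H ω *ᵥ x = d • fun i =>
      ((ω ^ 2 • (1 : Matrix (Fin nR) (Fin nR) ℝ) + L.R.A ^ 2)⁻¹ * (ω • L.R.B)) i 0 * M) ↔
      x = d • stateFormula L Q H ω M := by
  have hdet := (Matrix.isUnit_iff_isUnit_det _).1 hbr
  rw [stateFormula_eq, ← Matrix.mulVec_smul]
  constructor
  · intro h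
    rw [← h, Matrix.mulVec_mulVec, Matrix.nonsing_inv_mul _ hdet, Matrix.one_mulVec]
  · intro h
    rw [h, Matrix.mulVec_mulVec, Matrix.mul_nonsing_inv _ hdet, Matrix.one_mulVec]

end StateEquation

end ResetControl
end

/-! ### The main theorem -/

open ResetControl
theorem mainTheorem2 {nK nR nG nQ nH : ℕ}
    -- the loop, its reference, and the steady state of its base-linear system
    (L : Loop nK nR nG) (hwp : L.WellPosed) (hstab : L.BLSStable)
    (ω : ℝ) (hω : 0 < ω) (RI : ℂ)
    (hK : IsUnit (((ω * Complex.I : ℂ) • (1 : Matrix (Fin nK) (Fin nK) ℂ)) - toC L.K.A))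
    (hG : IsUnit (((ω * Complex.I : ℂ) • (1 : Matrix (Fin nG) (Fin nG) ℂ)) - toC L.G.A))
    (hR : IsUnit (ω ^ 2 • (1 : Matrix (Fin nR) (Fin nR) ℝ) + L.R.A ^ 2))
    (wL : Signals nK nR nG) (hL : L.IsBLSResponse (sinusoid ω RI) wL)
    (hLper : wL.StatesPeriodic (2 * Real.pi / ω))
    -- asymptotically stable state-space realizations of `Q_δ` and `H`
    (Q : StateSpace nQ nR 1) (hQ : Q.Realizes L.Qd) (hQs : AsympStable Q.A)
    (H : StateSpace nH nR nR) (hH : H.Realizes L.H) (hHs : AsympStable H.A)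
    -- the periodic response of the reset loop, with two resets per period
    (tρ : ℝ) (w : Signals nK nR nG)
    (hw : L.IsResetResponse (sinusoid ω RI) (resetInstants ω tρ) w)
    (hper : w.StatesPeriodic (2 * Real.pi / ω))
    (halt : ∀ t ∈ resetInstants ω tρ, w.xR (t + Real.pi / ω) = -w.xR t)
    -- the zero crossing of `q` at `tρ` is descending
    (hdesc : derivWithin (fun t => w.q t 0) (Set.Iic tρ) tρ < 0)
    -- at the resets, `q` crosses zero in the direction of the base-linear response
    (hdir : ∀ t ∈ resetInstants ω tρ,
      SignType.sign (derivWithin (fun s => w.q s 0) (Set.Iic t) t) =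
        SignType.sign (deriv (fun s => wL.q s 0) t))
    -- at the resets, the prior reset-induced impulse responses together stay below the peak
    -- of the base-linear response
    (hpeak : ∀ t ∈ resetInstants ω tρ,
      |(∑' p : ℕ, Q.impulse (((p : ℝ) + 1) * Real.pi / ω) *ᵥ
        w.xR (t - ((p : ℝ) + 1) * Real.pi / ω)) 0| < ⨆ s : ℝ, |wL.q s 0|) :
    -- no direct feed-through, and convergence of the two series
    (Q.D = 0 ∧ H.D = 0) ∧
    (Summable (seriesTerm ω Q.A) ∧ Summable (seriesTerm ω H.A)) ∧
    -- the reset state solves the exact state equation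
    w.xR tρ = stateRHS L Q H ω (L.blsMag ω RI) Real.arcsin phaseRotation (w.xR tρ) ∧
    (IsUnit (bracket L Q H ω) →
      -- the linearised state equation is solved by the formula and by nothing else
      (∀ x : Fin nR → ℝ,
        x = stateRHS L Q H ω (L.blsMag ω RI) (linearised Real.arcsin) (linearised phaseRotation) x ↔
          x = stateFormula L Q H ω (L.blsMag ω RI)) ∧
      -- the reset state is given by the formula up to second order in the phase shift
      (∀ i, |w.xR tρ i - stateFormula L Q H ω (L.blsMag ω RI) i| ≤
        Phi Q ω (L.blsMag ω RI) (w.xR tρ) ^ 2 / 2 *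
          |stateFormula L Q H ω (L.blsMag ω RI) i|)) := by
  have hRs := isUnit_smul_one_sub_of_sq hR
  have hres := Loop.eventually_resolvent_clA (L := L) hwp
  -- The sign of the output matrix reflects negative feedback: a reset impulse reaches `q` through
  -- `-Q_δ`.
  obtain ⟨hQD, hQi⟩ := Q.impulse_eq_of_eventually (C := -L.clQ) (A := L.clA) (B := L.clJump) (by
    filter_upwards [hQ, hres] with s h1 h2
    rw [h1, cplx_neg, Matrix.neg_mul, Matrix.neg_mul, h2.1, neg_neg])
  obtain ⟨hHD, hHi⟩ := H.impulse_eq_of_eventually (C := Loop.selR nK nR nG) (A := L.clA)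
    (B := L.clJump) (by
    filter_upwards [hH, hres] with s h1 h2
    rw [h1, h2.2])
  have htρ : tρ ∈ resetInstants ω tρ := ⟨0, by simp⟩
  have hδ := Loop.tendsto_sum_deviation hwp hstab hω hw hL hper hLper (halt tρ htρ)
  have hQx := Q.series_mulVec_eq hQs hω hQi hδ
  have hHx := H.series_mulVec_eq hHs hω hHi hδ
  rw [Matrix.neg_mulVec,
    (hw.interconnected.sub hL.interconnected).clQ_state hwp] at hQx
  rw [Loop.selR_mulVec] at hHx
  obtain ⟨z, hzM, hzq, hzx⟩ := Loop.periodicResponse_eq hwp hstab hω hK hRs hG hL hLper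
  -- `ζ` is the phasor of `q_L` turned to time `tρ`: its imaginary part is `q_L(tρ)`, and `ω` times
  -- its real part is the slope there.
  obtain ⟨ζ, hζ⟩ : ∃ ζ, ζ = Complex.exp ((ω * tρ : ℝ) * Complex.I) * z 0 := ⟨_, rfl⟩
  have hζM : ‖ζ‖ = L.blsMag ω RI := by
    rw [hζ, norm_mul, Complex.norm_exp_ofReal_mul_I, one_mul, hzM]
  have hζim : (Q.series ω *ᵥ w.xR tρ) 0 = ζ.im := by
    rw [hQx, hζ]
    change -(w.q tρ 0 - wL.q tρ 0) = _
    rw [hw.zero_q tρ htρ, hzq]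
    simp [phasorSignal]
  have hζre : ζ.re < 0 := by
    have h1 := hdir tρ htρ
    rw [sign_neg hdesc, eq_comm, sign_eq_neg_one_iff] at h1
    have h2 : HasDerivAt (fun s => wL.q s 0) (ω * ζ.re) tρ := by
      have h := hasDerivAt_pi.1 (hasDerivAt_phasorSignal ω z tρ) 0
      refine (h.congr_deriv ?_).congr_of_eventuallyEq
        (Eventually.of_forall fun s => congr_fun (hzq s) 0)
      simp only [phasorSignal, Pi.smul_apply, smul_eq_mul]
      rw [mul_left_comm, ← hζ]
      simp
    rw [h2.deriv] at h1
    by_contra hc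
    exact absurd h1 (not_lt.2 (mul_nonneg hω.le (not_lt.1 hc)))
  generalize L.blsMag ω RI = M at hζM hzM ⊢
  -- `M = |ζ|`, and `Re ζ < 0` rules out `ζ = 0`.
  have hM : 0 < M := by
    rw [← hζM, norm_pos_iff]
    rintro h0
    simp [h0] at hζre
  have hσ : M * phaseArg Q ω M (w.xR tρ) = ζ.im := by
    rw [← hζim]
    exact mul_div_cancel₀ _ hM.ne'
  have hsq : ζ.re ^ 2 + ζ.im ^ 2 = M ^ 2 := by
    rw [← hζM, ← Complex.normSq_eq_norm_sq, Complex.normSq_apply]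
    ring
  have hσ1 : phaseArg Q ω M (w.xR tρ) ^ 2 ≤ 1 := by
    have h1 : M ^ 2 * phaseArg Q ω M (w.xR tρ) ^ 2 ≤ M ^ 2 * 1 := by
      rw [← mul_pow, hσ]
      nlinarith [sq_nonneg ζ.re]
    exact le_of_mul_le_mul_left h1 (by positivity)
  have hsin : Real.sin (Real.arcsin (phaseArg Q ω M (w.xR tρ))) = phaseArg Q ω M (w.xR tρ) :=
    Real.sin_arcsin (abs_le.1 ((sq_le_one_iff_abs_le_one _).1 hσ1)).1
      (abs_le.1 ((sq_le_one_iff_abs_le_one _).1 hσ1)).2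
  -- Both sides are nonnegative with equal squares. The sign of `Re ζ` is what selects the branch of
  -- the arcsine.
  have hcos : M * Real.cos (Real.arcsin (phaseArg Q ω M (w.xR tρ))) = -ζ.re := by
    refine (sq_eq_sq₀ (mul_nonneg hM.le (Real.cos_arcsin_nonneg _)) (neg_nonneg.2 hζre.le)).1 ?_
    rw [mul_pow, Real.cos_sq', hsin, mul_sub, ← mul_pow, hσ]
    linarith
  have hrot := phaseRotation_eq (Real.arcsin (phaseArg Q ω M (w.xR tρ)))
  rw [hsin] at hrot
  have hexact : w.xR tρ = stateRHS L Q H ω M Real.arcsin phaseRotation (w.xR tρ) := by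
    rw [eq_stateRHS_iff hR hM.ne' hrot]
    ext i
    have hxi : (H.series ω *ᵥ w.xR tρ) i = w.xR tρ i - wL.xR tρ i := congr_fun hHx i
    have hxL : wL.xR tρ i = (L.RLX (ω * Complex.I) i 0 * ζ).im := by
      rw [hzx, hζ]
      simp only [phasorSignal, Matrix.mulVec, dotProduct, Finset.univ_unique, Fin.default_eq_zero,
        Finset.sum_singleton]
      rw [mul_left_comm]
    rw [RLX_apply hR] at hxL
    rw [bracket_mulVec_apply, hxi, hxL, hζim]
    simp only [Pi.smul_apply, smul_eq_mul]
    rw [mul_comm (Real.cos _), mul_assoc, hcos]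
    simp
  refine ⟨⟨hQD, hHD⟩, ⟨summable_seriesTerm hQs hω, summable_seriesTerm hHs hω⟩, hexact,
    fun hbr => ⟨fun x => ?_, fun i => ?_⟩⟩
  · rw [eq_stateRHS_iff (d := 1) hR hM.ne'
      (by rw [linearised_arcsin, linearised_phaseRotation, Complex.ofReal_one, one_mul]),
      eq_smul_stateFormula_iff hbr, one_smul]
  · rw [eq_stateRHS_iff hR hM.ne' hrot, eq_smul_stateFormula_iff hbr] at hexact
    have hi := congr_fun hexact i
    -- Now `x_i = cos Φ · x̂_i`, so the relative error is exactly `1 - cos Φ`.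
    rw [Pi.smul_apply, smul_eq_mul] at hi
    rw [hi, Phi, ← sub_one_mul, abs_mul]
    refine mul_le_mul_of_nonneg_right ?_ (abs_nonneg _)
    rw [abs_sub_comm, abs_of_nonneg (sub_nonneg.2 (Real.cos_le_one _))]
    linarith [Real.one_sub_sq_div_two_le_cos
      (x := Real.arcsin (phaseArg Q ω M (w.xR tρ)))]
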